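/- **Theorem (sharp $L^4$ Strichartz estimate).** Let $\mathbb{T}=\mathbb{R}/\mathbb{Z}$ and $\square=\partial_{x_1}^2-\partial_{x_2}^2$ on $\mathbb{R}\times\mathbb{T}$. For $\phi\in L^2(\mathbb{R}\times\mathbb{T})$ let $e^{it\square}\phi$ denote the solution of the linear hyperbolic Schrödinger equation $i\partial_t u+\square u=0$, $u(0,\cdot)=\phi$, that is, the function whose Fourier transform at $(\xi_1,n)\in\mathbb{R}\times\mathbb{Z}$ is $e^{-4\pi^2 i t(\xi_1^2-n^2)}\,\widehat\phi(\xi_1,n)$, where $\widehat\phi(\xi_1,n)=\int_{\mathbb{R}\times\mathbb{T}}\phi(x)e^{-2\pi i(x_1\xi_1+x_2n)}\,dx$ (extended to $L^2$ by Plancherel's theorem). Then there is an absolute constant $C$ such that $$\|e^{it\square}\phi\|_{L^4_{t,x}([0,1]\times\mathbb{R}\times\mathbb{T})}\le C\,\|\phi\|_{L^2_x(\mathbb{R}\times\mathbb{T})}\qquad\text{for all }\phi\in L^2(\mathbb{R}\times\mathbb{T}).$$ -/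

import Mathlib

open MeasureTheory FourierTransform
open scoped ENNReal NNReal

/-- The cylinder `ℝ × 𝕋` with `𝕋 = ℝ / ℤ`, carrying the product of the Lebesgue measures. -/
abbrev Cylinder : Type := ℝ × UnitAddCircle

/-- The complex Hilbert space `L²(ℝ)`. -/
abbrev L2Line : Type := Lp ℂ 2 (volume : Measure ℝ)

/-- The complex Hilbert space `L²(ℝ × 𝕋)`. -/
abbrev L2Cylinder : Type := Lp ℂ 2 (volume : Measure Cylinder)

theorem volume_unitAddCircle :
    (volume : Measure UnitAddCircle) = AddCircle.haarAddCircle := by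
  have h := AddCircle.volume_eq_smul_haarAddCircle (T := 1)
  simpa using h

theorem norm_fourier_apply (n : ℤ) (x : UnitAddCircle) : ‖(fourier n x : ℂ)‖ = 1 := by
  rw [fourier_apply, Circle.norm_coe]

theorem isProbabilityMeasure_unitAddCircle :
    IsProbabilityMeasure (volume : Measure UnitAddCircle) := by
  rw [volume_unitAddCircle]; infer_instance

/-- The `n`-th Fourier coefficient in the periodic variable, as a function on the line:
`x₁ ↦ ∫_𝕋 φ(x₁, x₂) e^{-2πi n x₂} dx₂`. -/
noncomputable def partialCoeffFun (φ : Cylinder → ℂ) (n : ℤ) (x₁ : ℝ) : ℂ :=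
  ∫ x₂ : UnitAddCircle, fourier (-n) x₂ * φ (x₁, x₂)

theorem memLp_partialCoeffFun (φ : L2Cylinder) (n : ℤ) :
    MemLp (partialCoeffFun φ n) 2 (volume : Measure ℝ) := by
  have := isProbabilityMeasure_unitAddCircle
  have hφ : MemLp φ 2 ((volume : Measure ℝ).prod (volume : Measure UnitAddCircle)) := Lp.memLp φ
  have hm : AEStronglyMeasurable (fun p : Cylinder => fourier (-n) p.2 * φ p)
      ((volume : Measure ℝ).prod (volume : Measure UnitAddCircle)) :=
    (((fourier (-n)).continuous.comp continuous_snd).aestronglyMeasurable).mul hφ.1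
  refine ⟨hm.integral_prod_right', ?_⟩
  rw [eLpNorm_lt_top_iff_lintegral_rpow_enorm_lt_top (by norm_num) (by norm_num)]
  have hlt := (eLpNorm_lt_top_iff_lintegral_rpow_enorm_lt_top (by norm_num) (by norm_num)).1 hφ.2
  have hfib := hφ.1.prodMk_left
  rw [lintegral_prod _ (hφ.1.enorm.pow_const _)] at hlt
  refine lt_of_le_of_lt (lintegral_mono_ae ?_) hlt
  filter_upwards [hfib] with x hx
  have h1 : ‖partialCoeffFun φ n x‖ₑ ≤ eLpNorm (fun y => φ (x, y)) 1 volume := by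
    refine (enorm_integral_le_lintegral_enorm _).trans ?_
    rw [eLpNorm_one_eq_lintegral_enorm]
    refine lintegral_mono fun y => ?_
    rw [enorm_mul, ← ofReal_norm (fourier (-n) y), norm_fourier_apply, ENNReal.ofReal_one,
      one_mul]
  have h2 := h1.trans (eLpNorm_le_eLpNorm_of_exponent_le (q := 2) (by norm_num) hx)
  rw [eLpNorm_eq_lintegral_rpow_enorm_toReal (by norm_num) (by norm_num)] at h2
  calc ‖partialCoeffFun φ n x‖ₑ ^ (2 : ℝ≥0∞).toReal
      ≤ ((∫⁻ y : UnitAddCircle, ‖φ (x, y)‖ₑ ^ (2 : ℝ≥0∞).toReal) ^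
          (1 / (2 : ℝ≥0∞).toReal)) ^ (2 : ℝ≥0∞).toReal := by gcongr
    _ = _ := by rw [← ENNReal.rpow_mul]; simp

/-- `partialCoeffFun` as an element of `L²(ℝ)`. -/
noncomputable def partialCoeff (φ : L2Cylinder) (n : ℤ) : L2Line :=
  (memLp_partialCoeffFun φ n).toLp (partialCoeffFun φ n)

/-- The Fourier transform on `ℝ × 𝕋`: `cylinderFourier φ n` is the function
`ξ₁ ↦ φ̂(ξ₁, n) = ∫_{ℝ × 𝕋} φ(x) e^{-2πi (x₁ ξ₁ + x₂ n)} dx` in `L²(ℝ)`, where the integral in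
`x₁` is the Fourier transform on `L²(ℝ)` (the Plancherel extension). -/
noncomputable def cylinderFourier (φ : L2Cylinder) (n : ℤ) : L2Line :=
  𝓕 (partialCoeff φ n)

/-- The symbol of `exp (i t (∂₁² - ∂₂²))` at the frequency `(ξ₁, n)`. Since `∂ⱼ²` acts on
`e^{2πi x·ξ}` as `-4π² ξⱼ²`, it is `exp (-4π² i t (ξ₁² - n²))`. -/
noncomputable def flowSymbol (t : ℝ) (n : ℤ) (ξ₁ : ℝ) : ℂ :=
  Complex.exp (((-4 * Real.pi ^ 2 * t * (ξ₁ ^ 2 - (n : ℝ) ^ 2) : ℝ) : ℂ) * Complex.I)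

theorem norm_flowSymbol (t : ℝ) (n : ℤ) (ξ₁ : ℝ) : ‖flowSymbol t n ξ₁‖ = 1 :=
  Complex.norm_exp_ofReal_mul_I _

theorem continuous_flowSymbol (t : ℝ) (n : ℤ) : Continuous (flowSymbol t n) := by
  unfold flowSymbol; fun_prop

theorem memLp_flowSymbol_mul (t : ℝ) (n : ℤ) (g : L2Line) :
    MemLp (fun ξ => flowSymbol t n ξ * g ξ) 2 (volume : Measure ℝ) :=
  (Lp.memLp g).of_le ((continuous_flowSymbol t n).aestronglyMeasurable.mul (Lp.memLp g).1)
    (Filter.Eventually.of_forall fun ξ => by simp [norm_flowSymbol])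

/-- Multiplication by the symbol at the periodic frequency `n`, on `L²(ℝ)`. -/
noncomputable def mulFlowSymbol (t : ℝ) (n : ℤ) (g : L2Line) : L2Line :=
  (memLp_flowSymbol_mul t n g).toLp (fun ξ => flowSymbol t n ξ * g ξ)

theorem memLp_tensorMode (g : L2Line) (n : ℤ) :
    MemLp (fun x : Cylinder => g x.1 * fourier n x.2) 2 (volume : Measure Cylinder) := by
  have := isProbabilityMeasure_unitAddCircle
  have hg : MemLp (fun x : Cylinder => g x.1) 2
      ((volume : Measure ℝ).prod (volume : Measure UnitAddCircle)) := (Lp.memLp g).comp_fst _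
  exact hg.of_le
    (hg.1.mul ((fourier n).continuous.comp continuous_snd).aestronglyMeasurable)
    (Filter.Eventually.of_forall fun x => by rw [norm_mul, norm_fourier_apply, mul_one])

/-- The function `(x₁, x₂) ↦ g(x₁) e^{2πi n x₂}` in `L²(ℝ × 𝕋)`. -/
noncomputable def tensorMode (g : L2Line) (n : ℤ) : L2Cylinder :=
  (memLp_tensorMode g n).toLp (fun x : Cylinder => g x.1 * fourier n x.2)

/-- The part of the evolution at the periodic frequency `n`:
`(∫_ℝ e^{2πi x₁ ξ₁} e^{-4π² i t (ξ₁² - n²)} φ̂(ξ₁, n) dξ₁) e^{2πi n x₂}`. -/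
noncomputable def flowMode (t : ℝ) (φ : L2Cylinder) (n : ℤ) : L2Cylinder :=
  tensorMode (𝓕⁻ (mulFlowSymbol t n (cylinderFourier φ n))) n

theorem coeFn_tensorMode (g : L2Line) (n : ℤ) :
    tensorMode g n =ᵐ[volume] fun x : Cylinder => g x.1 * fourier n x.2 :=
  (memLp_tensorMode g n).coeFn_toLp

theorem inner_tensorMode (g h : L2Line) (m n : ℤ) :
    inner ℂ (tensorMode g m) (tensorMode h n) = if m = n then inner ℂ g h else 0 := by
  have := isProbabilityMeasure_unitAddCircle
  have h1 : inner ℂ (tensorMode g m) (tensorMode h n) =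
      ∫ x : Cylinder, inner ℂ (g x.1) (h x.1) * (fourier (-m) x.2 * fourier n x.2) := by
    rw [L2.inner_def]
    refine integral_congr_ae ?_
    filter_upwards [coeFn_tensorMode g m, coeFn_tensorMode h n] with x hx hy
    rw [hx, hy, fourier_neg]
    simp only [RCLike.inner_apply, map_mul]
    ring
  rw [h1, Measure.volume_eq_prod,
    integral_prod_mul (fun x : ℝ => inner ℂ (g x) (h x))
      (fun y : UnitAddCircle => (fourier (-m) y * fourier n y : ℂ)), ← L2.inner_def]
  have h2 : ∫ y : UnitAddCircle, (fourier (-m) y * fourier n y : ℂ) = if m = n then 1 else 0 := by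
    have h3 := (orthonormal_iff_ite.1 (orthonormal_fourier (T := 1))) m n
    rw [ContinuousMap.inner_toLp AddCircle.haarAddCircle (fourier m) (fourier n)] at h3
    rw [volume_unitAddCircle, ← h3]
    refine integral_congr_ae (Filter.Eventually.of_forall fun y => ?_)
    simp only [fourier_neg]
    ring
  rw [h2]
  split_ifs <;> simp

theorem tensorMode_add (g h : L2Line) (n : ℤ) :
    tensorMode (g + h) n = tensorMode g n + tensorMode h n := by
  have := isProbabilityMeasure_unitAddCircle
  have hae : ∀ᵐ x : Cylinder, (g + h : L2Line) x.1 = g x.1 + h x.1 :=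
    Measure.quasiMeasurePreserving_fst.ae (Lp.coeFn_add g h)
  refine Lp.ext ?_
  filter_upwards [coeFn_tensorMode (g + h) n, coeFn_tensorMode g n, coeFn_tensorMode h n,
    Lp.coeFn_add (tensorMode g n) (tensorMode h n), hae] with x h1 h2 h3 h4 h5
  rw [h1, h4, Pi.add_apply, h2, h3, h5]
  ring

theorem tensorMode_smul (c : ℂ) (g : L2Line) (n : ℤ) :
    tensorMode (c • g) n = c • tensorMode g n := by
  have := isProbabilityMeasure_unitAddCircle
  have hae : ∀ᵐ x : Cylinder, (c • g : L2Line) x.1 = c * g x.1 :=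
    Measure.quasiMeasurePreserving_fst.ae (Lp.coeFn_smul c g)
  refine Lp.ext ?_
  filter_upwards [coeFn_tensorMode (c • g) n, coeFn_tensorMode g n,
    Lp.coeFn_smul c (tensorMode g n), hae] with x h1 h2 h4 h5
  rw [h1, h4, Pi.smul_apply, h2, h5, smul_eq_mul]
  ring

theorem norm_tensorMode (g : L2Line) (n : ℤ) : ‖tensorMode g n‖ = ‖g‖ := by
  rw [@norm_eq_sqrt_re_inner ℂ, inner_tensorMode, if_pos rfl, ← @norm_eq_sqrt_re_inner ℂ]

/-- `tensorMode · n` as a linear isometry from `L²(ℝ)` to `L²(ℝ × 𝕋)`. -/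
noncomputable def tensorModeIsometry (n : ℤ) : L2Line →ₗᵢ[ℂ] L2Cylinder where
  toFun g := tensorMode g n
  map_add' g h := tensorMode_add g h n
  map_smul' c g := tensorMode_smul c g n
  norm_map' g := norm_tensorMode g n

theorem orthogonalFamily_tensorMode :
    OrthogonalFamily ℂ (fun _ : ℤ => L2Line) tensorModeIsometry := by
  intro m n hmn g h
  exact (inner_tensorMode g h m n).trans (if_neg hmn)

theorem norm_mulFlowSymbol (t : ℝ) (n : ℤ) (g : L2Line) : ‖mulFlowSymbol t n g‖ = ‖g‖ := by
  rw [mulFlowSymbol, Lp.norm_toLp, Lp.norm_def]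
  congr 1
  exact eLpNorm_congr_norm_ae (Filter.Eventually.of_forall fun ξ => by
    rw [norm_mul, norm_flowSymbol, one_mul])

theorem norm_fourierInv_mulFlowSymbol (t : ℝ) (φ : L2Cylinder) (n : ℤ) :
    ‖(𝓕⁻ (mulFlowSymbol t n (cylinderFourier φ n)) : L2Line)‖ = ‖partialCoeff φ n‖ := by
  rw [← Lp.norm_fourier_eq, fourier_fourierInv_eq, norm_mulFlowSymbol, cylinderFourier,
    Lp.norm_fourier_eq]

theorem partialCoeff_tensorMode_inner (φ : L2Cylinder) (g : L2Line) (n : ℤ) :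
    inner ℂ (tensorMode g n) φ = inner ℂ g (partialCoeff φ n) := by
  have := isProbabilityMeasure_unitAddCircle
  have hint : Integrable (fun x : Cylinder => inner ℂ (g x.1) (fourier (-n) x.2 * φ x))
      ((volume : Measure ℝ).prod (volume : Measure UnitAddCircle)) := by
    refine (L2.integrable_inner (𝕜 := ℂ) (tensorMode g n) φ).congr ?_
    filter_upwards [coeFn_tensorMode g n] with x hx
    rw [hx, fourier_neg]
    simp only [RCLike.inner_apply, map_mul]
    ring
  rw [L2.inner_def, L2.inner_def]
  calc ∫ x : Cylinder, inner ℂ (tensorMode g n x) (φ x)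
      = ∫ x : Cylinder, inner ℂ (g x.1) (fourier (-n) x.2 * φ x) := by
        refine integral_congr_ae ?_
        filter_upwards [coeFn_tensorMode g n] with x hx
        rw [hx, fourier_neg]
        simp only [RCLike.inner_apply, map_mul]
        ring
    _ = ∫ x₁ : ℝ, ∫ x₂ : UnitAddCircle, inner ℂ (g x₁) (fourier (-n) x₂ * φ (x₁, x₂)) :=
        integral_prod _ hint
    _ = ∫ x₁ : ℝ, inner ℂ (g x₁) (partialCoeff φ n x₁) := by
        refine integral_congr_ae ?_
        filter_upwards [(memLp_partialCoeffFun φ n).coeFn_toLp] with x hx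
        rw [partialCoeff, hx, partialCoeffFun]
        simp only [RCLike.inner_apply]
        rw [integral_mul_const]

theorem sum_sq_norm_partialCoeff_le (φ : L2Cylinder) (s : Finset ℤ) :
    ∑ n ∈ s, ‖partialCoeff φ n‖ ^ 2 ≤ ‖φ‖ ^ 2 := by
  have h1 : ∀ n, RCLike.re (inner ℂ (tensorMode (partialCoeff φ n) n) φ) =
      ‖partialCoeff φ n‖ ^ 2 := fun n => by
    rw [partialCoeff_tensorMode_inner, inner_self_eq_norm_sq]
  have h2 : ‖∑ n ∈ s, tensorMode (partialCoeff φ n) n‖ ^ 2 = ∑ n ∈ s, ‖partialCoeff φ n‖ ^ 2 :=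
    orthogonalFamily_tensorMode.norm_sum (fun n => partialCoeff φ n) s
  have h3 := @norm_sub_sq ℂ _ _ _ _ (∑ n ∈ s, tensorMode (partialCoeff φ n) n) φ
  rw [sum_inner, map_sum, h2, Finset.sum_congr rfl fun n _ => h1 n] at h3
  nlinarith [sq_nonneg ‖∑ n ∈ s, tensorMode (partialCoeff φ n) n - φ‖]

theorem summable_flowMode (t : ℝ) (φ : L2Cylinder) : Summable (flowMode t φ) := by
  have h := (orthogonalFamily_tensorMode.summable_iff_norm_sq_summable
    (fun n => (𝓕⁻ (mulFlowSymbol t n (cylinderFourier φ n)) : L2Line))).2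
  refine h ?_
  simp only [norm_fourierInv_mulFlowSymbol]
  exact summable_of_sum_le (fun _ => sq_nonneg _) (sum_sq_norm_partialCoeff_le φ)

/-- The hyperbolic Schrödinger flow `e^{it(∂₁² - ∂₂²)} φ` on `L²(ℝ × 𝕋)`: the sum over all
periodic frequencies, convergent in `L²(ℝ × 𝕋)` by orthogonality. -/
noncomputable def hyperbolicFlow (t : ℝ) (φ : L2Cylinder) : L2Cylinder :=
  ∑' n : ℤ, flowMode t φ n

theorem inner_partialCoeff_hyperbolicFlow (t : ℝ) (φ : L2Cylinder) (g : L2Line) (n : ℤ) :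
    inner ℂ g (partialCoeff (hyperbolicFlow t φ) n) =
      inner ℂ g (𝓕⁻ (mulFlowSymbol t n (cylinderFourier φ n))) := by
  rw [← partialCoeff_tensorMode_inner]
  have h := ((innerSL ℂ (tensorMode g n)).hasSum (summable_flowMode t φ).hasSum)
  have h' := h.unique (hasSum_single n ?_)
  · simpa [flowMode, inner_tensorMode, hyperbolicFlow] using h'
  · intro m hm; simp [flowMode, inner_tensorMode, Ne.symm hm]

/-- The flow is the Fourier multiplier with symbol `exp (-4π² i t (ξ₁² - n²))`. -/
theorem cylinderFourier_hyperbolicFlow (t : ℝ) (φ : L2Cylinder) (n : ℤ) :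
    cylinderFourier (hyperbolicFlow t φ) n = mulFlowSymbol t n (cylinderFourier φ n) := by
  rw [cylinderFourier, ext_inner_left ℂ (fun g => inner_partialCoeff_hyperbolicFlow t φ g n), fourier_fourierInv_eq]

/-- The measure of the space-time region `[0, 1] × ℝ × 𝕋`. -/
noncomputable def spaceTimeMeasure : Measure (ℝ × Cylinder) :=
  ((volume : Measure ℝ).restrict (Set.Icc 0 1)).prod (volume : Measure Cylinder)

/-- `u` is the flow `(t, x) ↦ (e^{it(∂₁² - ∂₂²)} φ)(x)`, as a measurable function on
`[0, 1] × ℝ × 𝕋`. This determines `u` up to equality almost everywhere. -/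
def RepresentsFlow (φ : L2Cylinder) (u : ℝ × Cylinder → ℂ) : Prop :=
  AEStronglyMeasurable u spaceTimeMeasure ∧
    ∀ᵐ t ∂((volume : Measure ℝ).restrict (Set.Icc 0 1)),
      (fun x => u (t, x)) =ᵐ[volume] hyperbolicFlow t φ

/-!
For a fixed time, `u ^ 2` has Fourier transform the self-convolution on `ℝ × ℤ` of the evolved
Fourier transform of `φ`, so Plancherel turns the fourth power of the `L⁴` norm into the squared
`L²` norm of an oscillatory integral. Dominating `[0, 1]` by a Gaussian weight in time and
integrating in time first yields a quadrilinear form over the parallelograms `p, q, c - p, c - q`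
of frequencies. The symbol `ξ² - n²` has the polarisation `w₁z₁ - w₂z₂` in the sides `w, z` of the
parallelogram, and the form carries the weight `exp (-(w₁z₁ - w₂z₂)²)`.

It remains to bound this form by `‖φ‖⁴`, which Schur's test does in three regimes, up to exchanging
`w` and `z`:
* if `w` is horizontal, the weight is `exp (-(w₁z₁)²)`; with the diagonal `w + z` or `w - z` fixed,
  it is dominated by a sum of two Gaussians in `w₁`;
* if `0 < |w₂| ≤ 2|z₁|`, fix `z`: each of the at most `4|z₁|` heights `w₂` contributes the Gaussian
  integral `√π / |z₁|`;
* otherwise both sides are steep, `|w₁z₁| ≤ |w₂z₂| / 4`, and with `z` fixed the decay of the weight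
  in `w₂z₂` makes the sum over `w₂` converge.

General `φ ∈ L²` follow by approximating the Fourier transform, fast enough for the solutions to
converge almost everywhere, and Fatou's lemma.
-/

section Lp

variable {α E : Type*} [MeasurableSpace α] [NormedAddCommGroup E] {μ : Measure α} {p : ℝ≥0∞}

theorem eLpNorm_ofNat_pow_eq_lintegral (n : ℕ) [n.AtLeastTwo] (f : α → E) :
    eLpNorm f ofNat(n) μ ^ (OfNat.ofNat n : ℕ) = ∫⁻ x, ‖f x‖ₑ ^ (OfNat.ofNat n : ℕ) ∂μ := by
  have h := eLpNorm_nnreal_pow_eq_lintegral (f := f) (μ := μ) (p := ofNat(n))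
    (NeZero.ne (OfNat.ofNat n))
  simpa only [NNReal.coe_ofNat, ENNReal.rpow_ofNat, ENNReal.coe_ofNat] using h

theorem ae_tendsto_of_tsum_eLpNorm_sub_ne_top (hp : 1 ≤ p) {f : ℕ → α → E} {g : α → E}
    (hf : ∀ k, AEStronglyMeasurable (f k) μ) (hg : AEStronglyMeasurable g μ)
    (h : ∑' k, eLpNorm (f k - g) p μ ≠ ∞) :
    ∀ᵐ x ∂μ, Filter.Tendsto (fun k => f k x) Filter.atTop (nhds (g x)) := by
  filter_upwards [summable_norm_of_tsum_eLpNorm_ne_top hp (fun k => (hf k).sub hg) h] with x hx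
  exact tendsto_iff_norm_sub_tendsto_zero.2 hx.tendsto_atTop_zero

theorem exists_continuous_hasCompactSupport_tsum_eLpNorm_sub_ne_top [NormedSpace ℝ E]
    [TopologicalSpace α] [NormalSpace α] [R1Space α] [WeaklyLocallyCompactSpace α] [BorelSpace α]
    [μ.Regular] (hp : p ≠ ∞) {f : α → E} (hf : MemLp f p μ) :
    ∃ h : ℕ → α → E, (∀ k, Continuous (h k)) ∧ (∀ k, HasCompactSupport (h k)) ∧
      ∑' k, eLpNorm (h k - f) p μ ≠ ∞ := by
  have approx (k : ℕ) := hf.exists_hasCompactSupport_eLpNorm_sub_le hp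
    (pow_ne_zero k (ENNReal.inv_ne_zero.2 ENNReal.ofNat_ne_top : (2⁻¹ : ℝ≥0∞) ≠ 0))
  choose h hs hle hc _ using approx
  refine ⟨h, hc, hs, ne_top_of_le_ne_top (b := ∑' k : ℕ, (2⁻¹ : ℝ≥0∞) ^ k) ?_ ?_⟩
  · simp [ENNReal.tsum_geometric, ENNReal.one_sub_inv_two]
  · exact ENNReal.tsum_le_tsum fun k => (eLpNorm_sub_comm _ _ _ _).trans_le (hle k)

end Lp

/-! ### Schur's test and parallelogram forms -/

theorem ennreal_mul_le_sq_add_sq (x y : ℝ≥0∞) : x * y ≤ x ^ 2 + y ^ 2 := by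
  rcases le_total x y with h | h
  · exact (mul_le_mul_left h y).trans ((sq y).symm.trans_le le_add_self)
  · exact (mul_le_mul_right h x).trans ((sq x).symm.trans_le le_self_add)

section Schur

variable {α β : Type*} [MeasurableSpace α] [MeasurableSpace β] {μ : Measure α} {ν : Measure β}
  [SFinite μ] [SFinite ν]

theorem lintegral_lintegral_mul_kernel_le_of_schur {f : α → ℝ≥0∞} {g : β → ℝ≥0∞}
    {k : α → β → ℝ≥0∞} (hf : Measurable f) (hg : Measurable g)
    (hk : Measurable (Function.uncurry k)) {A B : ℝ≥0∞} (hA : ∀ x, ∫⁻ y, k x y ∂ν ≤ A)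
    (hB : ∀ y, ∫⁻ x, k x y ∂μ ≤ B) :
    ∫⁻ x, ∫⁻ y, f x * g y * k x y ∂ν ∂μ ≤ A * ∫⁻ x, f x ^ 2 ∂μ + B * ∫⁻ y, g y ^ 2 ∂ν := by
  calc ∫⁻ x, ∫⁻ y, f x * g y * k x y ∂ν ∂μ
      ≤ ∫⁻ x, ∫⁻ y, (f x ^ 2 * k x y + g y ^ 2 * k x y) ∂ν ∂μ := by
        gcongr with x y
        rw [← add_mul]
        gcongr
        exact ennreal_mul_le_sq_add_sq _ _
    _ = ∫⁻ x, f x ^ 2 * ∫⁻ y, k x y ∂ν ∂μ + ∫⁻ y, g y ^ 2 * ∫⁻ x, k x y ∂μ ∂ν := by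
        simp_rw [fun x => lintegral_add_left (μ := ν) (f := fun y => f x ^ 2 * k x y)
          (by fun_prop) (fun y => g y ^ 2 * k x y)]
        rw [lintegral_add_left (by fun_prop),
          lintegral_lintegral_swap (f := fun x y => g y ^ 2 * k x y) (by fun_prop)]
        congr! with x y
        · exact lintegral_const_mul _ (by fun_prop)
        · exact lintegral_const_mul _ (by fun_prop)
    _ ≤ ∫⁻ x, f x ^ 2 * A ∂μ + ∫⁻ y, g y ^ 2 * B ∂ν := by gcongr <;> apply_assumption
    _ = A * ∫⁻ x, f x ^ 2 ∂μ + B * ∫⁻ y, g y ^ 2 ∂ν := by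
        rw [lintegral_mul_const _ (by fun_prop), lintegral_mul_const _ (by fun_prop),
          mul_comm A, mul_comm B]

end Schur

theorem lintegral_lintegral_lintegral_rotate {α β γ : Type*} [MeasurableSpace α]
    [MeasurableSpace β] [MeasurableSpace γ] {μ : Measure α} {ν : Measure β} {ρ : Measure γ}
    [SFinite μ] [SFinite ν] [SFinite ρ] {f : α → β → γ → ℝ≥0∞}
    (hf : Measurable fun x : α × β × γ => f x.1 x.2.1 x.2.2) :
    ∫⁻ x, ∫⁻ y, ∫⁻ z, f x y z ∂ρ ∂ν ∂μ = ∫⁻ y, ∫⁻ z, ∫⁻ x, f x y z ∂μ ∂ρ ∂ν := by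
  have hxy : Measurable fun x : (α × β) × γ => f x.1.1 x.1.2 x.2 :=
    hf.comp (measurable_fst.fst.prodMk (measurable_fst.snd.prodMk measurable_snd))
  rw [lintegral_lintegral_swap hxy.lintegral_prod_right'.aemeasurable]
  exact lintegral_congr fun y => lintegral_lintegral_swap (by fun_prop)

/-- The quadrilinear form over parallelograms with opposite vertices `p, c - p` and `q, c - q`,
hence with sides `p - q` and `p + q - c`, weighted by a function `K` of the two sides. -/
noncomputable def parallelogramForm {G : Type*} [AddCommGroup G] [MeasurableSpace G]
    (μ : Measure G) (F : G → ℝ≥0∞) (K : G × G → ℝ≥0∞) : ℝ≥0∞ :=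
  ∫⁻ c, ∫⁻ p, ∫⁻ q, F p * F (c - p) * (F q * F (c - q)) * K (p - q, p + q - c) ∂μ ∂μ ∂μ

section ParallelogramForm

variable {G : Type*} [AddCommGroup G] [MeasurableSpace G] {μ : Measure G} {F : G → ℝ≥0∞}
  {K K' : G × G → ℝ≥0∞}

theorem parallelogramForm_mono (h : K ≤ K') :
    parallelogramForm μ F K ≤ parallelogramForm μ F K' := by
  unfold parallelogramForm
  gcongr
  exact h _

variable [MeasurableAdd₂ G] [MeasurableNeg G]

theorem parallelogramForm_comp_swap [μ.IsAddLeftInvariant] [μ.IsNegInvariant] :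
    parallelogramForm μ F (K ∘ Prod.swap) = parallelogramForm μ F K := by
  unfold parallelogramForm
  refine lintegral_congr fun c => lintegral_congr fun p => ?_
  rw [← lintegral_sub_left_eq_self _ c]
  refine lintegral_congr fun q => ?_
  rw [sub_sub_cancel, mul_comm (F (c - q)), Function.comp_apply, Prod.swap_prod_mk,
    show p + (c - q) - c = p - q by abel, show p - (c - q) = p + q - c by abel]

variable [SFinite μ]

theorem parallelogramForm_add (hF : Measurable F) (hK : Measurable K) :
    parallelogramForm μ F (K + K') = parallelogramForm μ F K + parallelogramForm μ F K' := by
  unfold parallelogramForm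
  simp_rw [Pi.add_apply, mul_add]
  rw [← lintegral_add_left (by fun_prop)]
  refine lintegral_congr fun c => ?_
  rw [← lintegral_add_left (by fun_prop)]
  refine lintegral_congr fun p => ?_
  rw [← lintegral_add_left (by fun_prop)]

variable [μ.IsAddLeftInvariant]

theorem lintegral_lintegral_sq_mul_sub (hF : Measurable F) :
    ∫⁻ c, ∫⁻ p, (F p * F (c - p)) ^ 2 ∂μ ∂μ = (∫⁻ p, F p ^ 2 ∂μ) ^ 2 := by
  rw [lintegral_lintegral_swap (by fun_prop)]
  simp_rw [mul_pow, fun p => lintegral_const_mul (μ := μ) (F p ^ 2)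
    (f := fun c => F (c - p) ^ 2) (by fun_prop),
    fun p => lintegral_sub_right_eq_self (μ := μ) (fun c => F c ^ 2) p]
  rw [lintegral_mul_const _ (by fun_prop), sq]

variable [μ.IsNegInvariant]

theorem parallelogramForm_le_of_diagonal (hF : Measurable F) (hK : Measurable K) {C : ℝ≥0∞}
    (hsub : ∀ s, ∫⁻ w, K (w, s - w) ∂μ ≤ C) (hadd : ∀ s, ∫⁻ w, K (w, s + w) ∂μ ≤ C) :
    parallelogramForm μ F K ≤ 2 * C * (∫⁻ p, F p ^ 2 ∂μ) ^ 2 := by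
  have hleft (c p : G) : ∫⁻ q, K (p - q, p + q - c) ∂μ ≤ C := by
    refine le_of_eq_of_le ?_ (hsub (p + p - c))
    rw [← lintegral_sub_left_eq_self _ p]
    congr! 3 with w
    all_goals abel_nf
  have hright (c q : G) : ∫⁻ p, K (p - q, p + q - c) ∂μ ≤ C := by
    refine le_of_eq_of_le ?_ (hadd (q + q - c))
    rw [← lintegral_add_right_eq_self _ q]
    congr! 3 with w
    all_goals abel_nf
  calc parallelogramForm μ F K
      ≤ ∫⁻ c, 2 * C * ∫⁻ p, (F p * F (c - p)) ^ 2 ∂μ ∂μ := by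
        refine lintegral_mono fun c => ?_
        refine (lintegral_lintegral_mul_kernel_le_of_schur (f := fun p => F p * F (c - p))
          (g := fun q => F q * F (c - q)) (k := fun p q => K (p - q, p + q - c)) (by fun_prop)
          (by fun_prop) (by fun_prop) (hleft c) (hright c)).trans_eq ?_
        rw [mul_assoc, two_mul]
    _ = 2 * C * (∫⁻ p, F p ^ 2 ∂μ) ^ 2 := by
        rw [lintegral_const_mul _ (by fun_prop), lintegral_lintegral_sq_mul_sub hF]

theorem parallelogramForm_eq_lintegral_side (hF : Measurable F) (hK : Measurable K) :
    parallelogramForm μ F K =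
      ∫⁻ z, ∫⁻ p, ∫⁻ q, F p * F (p - z) * (F q * F (q - z)) * K (p - q, z) ∂μ ∂μ ∂μ := by
  unfold parallelogramForm
  refine (lintegral_lintegral_lintegral_rotate (by fun_prop)).trans
    (Eq.trans ?_ (lintegral_lintegral_lintegral_rotate (by fun_prop)).symm)
  refine lintegral_congr fun p => lintegral_congr fun q => ?_
  rw [← lintegral_sub_left_eq_self _ (p + q)]
  refine lintegral_congr fun z => ?_
  rw [show p + q - z - p = q - z by abel, show p + q - z - q = p - z by abel,
    show p + q - (p + q - z) = z by abel]
  ring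

theorem parallelogramForm_le_of_side (hF : Measurable F) (hK : Measurable K) {C : ℝ≥0∞}
    (hC : ∀ z, ∫⁻ w, K (w, z) ∂μ ≤ C) :
    parallelogramForm μ F K ≤ 2 * C * (∫⁻ p, F p ^ 2 ∂μ) ^ 2 := by
  have hleft (z p : G) : ∫⁻ q, K (p - q, z) ∂μ ≤ C :=
    (lintegral_sub_left_eq_self (fun w => K (w, z)) p).trans_le (hC z)
  have hright (z q : G) : ∫⁻ p, K (p - q, z) ∂μ ≤ C :=
    (lintegral_sub_right_eq_self (fun w => K (w, z)) q).trans_le (hC z)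
  calc parallelogramForm μ F K
      ≤ ∫⁻ z, 2 * C * ∫⁻ p, (F p * F (p - z)) ^ 2 ∂μ ∂μ := by
        rw [parallelogramForm_eq_lintegral_side hF hK]
        refine lintegral_mono fun z => ?_
        refine (lintegral_lintegral_mul_kernel_le_of_schur (f := fun p => F p * F (p - z))
          (k := fun p q => K (p - q, z)) (by fun_prop)
          (by fun_prop) (by fun_prop) (hleft z) (hright z)).trans_eq ?_
        rw [mul_assoc, two_mul]
    _ = 2 * C * (∫⁻ p, F p ^ 2 ∂μ) ^ 2 := by
        rw [lintegral_const_mul _ (by fun_prop), lintegral_lintegral_swap (by fun_prop),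
          ← lintegral_lintegral_sq_mul_sub hF,
          lintegral_lintegral_swap (f := fun c p => (F p * F (c - p)) ^ 2) (by fun_prop)]
        congr! 1
        exact lintegral_congr fun p =>
          (lintegral_sub_left_eq_self (μ := μ) (fun c => (F p * F c) ^ 2) p).trans
          (lintegral_sub_right_eq_self (fun c => (F p * F c) ^ 2) p).symm

end ParallelogramForm

/-! ### Resonant parallelograms -/

section GaussianIntegrals

theorem lintegral_gaussian {b : ℝ} (hb : 0 < b) :
    ∫⁻ x : ℝ, ENNReal.ofReal (Real.exp (-b * x ^ 2)) = ENNReal.ofReal √(Real.pi / b) := by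
  rw [← integral_gaussian, ofReal_integral_eq_lintegral_ofReal (integrable_exp_neg_mul_sq hb)
    (Filter.Eventually.of_forall fun x => (Real.exp_pos _).le)]

theorem lintegral_gaussian_affine {a : ℝ} (ha : a ≠ 0) (b : ℝ) :
    ∫⁻ x : ℝ, ENNReal.ofReal (Real.exp (-(x * a - b) ^ 2)) =
      ENNReal.ofReal (√Real.pi / |a|) := by
  have h (x : ℝ) : -(x * a - b) ^ 2 = -(a ^ 2) * (x - b / a) ^ 2 := by field_simp
  simp_rw [h]
  rw [lintegral_sub_right_eq_self (fun x : ℝ => ENNReal.ofReal (Real.exp (-(a ^ 2) * x ^ 2))),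
    lintegral_gaussian (by positivity), Real.sqrt_div Real.pi_nonneg, Real.sqrt_sq_eq_abs]

theorem exp_neg_mul_sq_le_of_abs_le {x y : ℝ} (h : |x| ≤ |y|) :
    Real.exp (-(x * y) ^ 2) ≤ Real.exp 1 * Real.exp (-1 * x ^ 2) := by
  rw [← Real.exp_add, Real.exp_le_exp]
  nlinarith [mul_le_mul_of_nonneg_left (sq_le_sq.2 h) (sq_nonneg x), sq_nonneg (x ^ 2 - 1)]

theorem exp_neg_mul_sq_le (x y : ℝ) :
    Real.exp (-(x * y) ^ 2) ≤
      Real.exp 1 * (Real.exp (-1 * x ^ 2) + Real.exp (-1 * y ^ 2)) := by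
  rw [mul_add]
  rcases le_total |x| |y| with h | h
  · exact le_add_of_le_of_nonneg (exp_neg_mul_sq_le_of_abs_le h) (by positivity)
  · rw [mul_comm x y]
    exact le_add_of_nonneg_of_le (by positivity) (exp_neg_mul_sq_le_of_abs_le h)

theorem lintegral_exp_neg_mul_sub_sq_le (σ : ℝ) :
    ∫⁻ x : ℝ, ENNReal.ofReal (Real.exp (-(x * (σ - x)) ^ 2)) ≤
      ENNReal.ofReal (Real.exp 1) * (2 * ENNReal.ofReal √Real.pi) := by
  have gaussian := lintegral_gaussian one_pos
  rw [div_one] at gaussian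
  calc ∫⁻ x : ℝ, ENNReal.ofReal (Real.exp (-(x * (σ - x)) ^ 2))
      ≤ ∫⁻ x : ℝ, ENNReal.ofReal (Real.exp 1) * (ENNReal.ofReal (Real.exp (-1 * x ^ 2)) +
          ENNReal.ofReal (Real.exp (-1 * (σ - x) ^ 2))) := by
        refine lintegral_mono fun x => ?_
        rw [← ENNReal.ofReal_add (by positivity) (by positivity),
          ← ENNReal.ofReal_mul (by positivity)]
        exact ENNReal.ofReal_le_ofReal (exp_neg_mul_sq_le _ _)
    _ = ENNReal.ofReal (Real.exp 1) * (2 * ENNReal.ofReal √Real.pi) := by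
        rw [lintegral_const_mul _ (by fun_prop), lintegral_add_left (by fun_prop), gaussian,
          lintegral_sub_left_eq_self
            (fun x : ℝ => ENNReal.ofReal (Real.exp (-1 * x ^ 2))) σ, gaussian, two_mul]

end GaussianIntegrals

theorem count_setOf_ne_zero_abs_le {r : ℝ} (hr : 0 ≤ r) :
    Measure.count {n : ℤ | n ≠ 0 ∧ |(n : ℝ)| ≤ r} ≤ ENNReal.ofReal (2 * r) := by
  have floor_nonneg : 0 ≤ ⌊r⌋ := Int.floor_nonneg.2 hr
  have eq_finset : {n : ℤ | n ≠ 0 ∧ |(n : ℝ)| ≤ r} =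
      ((Finset.Icc (-⌊r⌋) ⌊r⌋).erase 0 : Finset ℤ) := by
    ext n
    rw [Set.mem_ofPred_eq, Finset.mem_coe, Finset.mem_erase, Finset.mem_Icc, ← abs_le, Int.le_floor,
      Int.cast_abs]
  have card_eq : (((Finset.Icc (-⌊r⌋) ⌊r⌋).erase 0).card : ℤ) = 2 * ⌊r⌋ := by
    rw [Finset.card_erase_of_mem (by simp [floor_nonneg]), Int.card_Icc]
    lia
  rw [eq_finset, Measure.count_apply_finset, ← ENNReal.ofReal_natCast]
  refine ENNReal.ofReal_le_ofReal ?_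
  calc (((Finset.Icc (-⌊r⌋) ⌊r⌋).erase 0).card : ℝ) = 2 * ⌊r⌋ := by exact_mod_cast card_eq
    _ ≤ 2 * r := by gcongr; exact Int.floor_le r

/-- The frequency space `ℝ × ℤ`, dual to the cylinder `ℝ × 𝕋`. -/
abbrev Frequency : Type := ℝ × ℤ

/-- Haar measure on the frequency space, normalised to be dual to the measure of the cylinder. -/
noncomputable abbrev frequencyMeasure : Measure Frequency :=
  (volume : Measure ℝ).prod Measure.count

instance isAddHaarMeasure_count_int : (Measure.count : Measure ℤ).IsAddHaarMeasure where
  lt_top_of_isCompact _ hK := Measure.count_apply_lt_top.2 (isCompact_iff_finite.1 hK)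
  open_pos _ _ hU := Measure.count_ne_zero hU

/-- The bilinear form `w₁z₁ - w₂z₂` polarising the symbol `ξ² - n²` of `□`. On the sides `w, z` of a
parallelogram it measures by how much the two pairs of opposite vertices fail to be resonant. -/
def resonance (s : Frequency × Frequency) : ℝ := s.1.1 * s.2.1 - s.1.2 * s.2.2

/-- The weight `exp (-resonance²)`, which concentrates on nearly resonant parallelograms. -/
noncomputable def resonanceKernel (s : Frequency × Frequency) : ℝ≥0∞ :=
  ENNReal.ofReal (Real.exp (-resonance s ^ 2))

/-- The pairs of sides `(w, z)` with `w` horizontal. -/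
def flatPairs : Set (Frequency × Frequency) := {s | s.1.2 = 0}

/-- The pairs of sides `(w, z)` such that `w` is not horizontal and its height is controlled by the
width of `z`. -/
def transversalPairs : Set (Frequency × Frequency) :=
  {s | s.1.2 ≠ 0 ∧ |(s.1.2 : ℝ)| ≤ 2 * |s.2.1|}

/-- The pairs of non-horizontal sides, each narrow compared with the height of the other. -/
def steepPairs : Set (Frequency × Frequency) :=
  {s | s.1.2 ≠ 0 ∧ s.2.2 ≠ 0 ∧ 2 * |s.2.1| < |(s.1.2 : ℝ)| ∧ 2 * |s.1.1| < |(s.2.2 : ℝ)|}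

section Resonance

@[fun_prop]
theorem measurable_resonance : Measurable resonance := by
  unfold resonance
  fun_prop

@[fun_prop]
theorem measurable_resonanceKernel : Measurable resonanceKernel := by
  unfold resonanceKernel
  fun_prop

theorem resonanceKernel_swap (s : Frequency × Frequency) :
    resonanceKernel s.swap = resonanceKernel s := by
  simp only [resonanceKernel, resonance, Prod.fst_swap, Prod.snd_swap, mul_comm]

theorem measurableSet_flatPairs : MeasurableSet flatPairs := by
  unfold flatPairs
  measurability

theorem measurableSet_transversalPairs : MeasurableSet transversalPairs := by
  unfold transversalPairs
  measurability

theorem measurableSet_steepPairs : MeasurableSet steepPairs := by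
  unfold steepPairs
  measurability

theorem mem_flatPairs_or_transversalPairs_or_steepPairs (s : Frequency × Frequency) :
    (s ∈ flatPairs ∨ s ∈ transversalPairs) ∨
      (s.swap ∈ flatPairs ∨ s.swap ∈ transversalPairs) ∨ s ∈ steepPairs := by
  simp only [flatPairs, transversalPairs, steepPairs, Set.mem_ofPred_eq, Prod.fst_swap,
    Prod.snd_swap]
  grind

theorem resonanceKernel_le_sum_indicator :
    resonanceKernel ≤
      (flatPairs.indicator resonanceKernel + transversalPairs.indicator resonanceKernel) +
      (flatPairs.indicator resonanceKernel + transversalPairs.indicator resonanceKernel) ∘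
        Prod.swap + steepPairs.indicator resonanceKernel := by
  intro s
  simp only [Pi.add_apply, Function.comp_apply]
  obtain ((h | h) | (h | h) | h) := mem_flatPairs_or_transversalPairs_or_steepPairs s
  all_goals simp only [Set.indicator_of_mem h, resonanceKernel_swap]
  · exact le_self_add.trans (le_self_add.trans le_self_add)
  · exact le_add_self.trans (le_self_add.trans le_self_add)
  · exact le_self_add.trans (le_add_self.trans le_self_add)
  · exact le_add_self.trans (le_add_self.trans le_self_add)
  · exact le_add_self

theorem lintegral_indicator_flatPairs {z : Frequency → Frequency} (hz : Measurable z) :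
    ∫⁻ w, flatPairs.indicator resonanceKernel (w, z w) ∂frequencyMeasure =
      ∫⁻ x : ℝ, ENNReal.ofReal (Real.exp (-(x * (z (x, 0)).1) ^ 2)) := by
  have measurable_kernel : Measurable fun w => flatPairs.indicator resonanceKernel (w, z w) :=
    (measurable_resonanceKernel.indicator measurableSet_flatPairs).comp (by fun_prop)
  rw [lintegral_prod_symm _ measurable_kernel.aemeasurable, lintegral_count, tsum_eq_single 0]
  · refine lintegral_congr fun x => ?_
    rw [Set.indicator_of_mem (by rfl), resonanceKernel, resonance, Int.cast_zero, zero_mul,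
      sub_zero]
  · intro n hn
    simp [flatPairs, hn]

theorem lintegral_indicator_transversalPairs_le (z : Frequency) :
    ∫⁻ w, transversalPairs.indicator resonanceKernel (w, z) ∂frequencyMeasure ≤
      ENNReal.ofReal (4 * √Real.pi) := by
  have measurable_kernel : Measurable fun w => transversalPairs.indicator resonanceKernel (w, z) :=
    (measurable_resonanceKernel.indicator measurableSet_transversalPairs).comp (by fun_prop)
  set c := ENNReal.ofReal (√Real.pi / |z.1|) with c_def
  set heights : Set ℤ := {n | n ≠ 0 ∧ |(n : ℝ)| ≤ 2 * |z.1|} with heights_def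
  have slice_le (n : ℤ) :
      ∫⁻ x : ℝ, transversalPairs.indicator resonanceKernel ((x, n), z) ≤
        heights.indicator (fun _ => c) n := by
    by_cases hn : n ∈ heights
    · have hz : z.1 ≠ 0 := by
        rintro hz
        rw [heights_def, hz, abs_zero, mul_zero] at hn
        exact hn.1 (Int.cast_eq_zero.1 (abs_nonpos_iff.1 hn.2))
      rw [Set.indicator_of_mem hn, c_def, ← lintegral_gaussian_affine hz (n * z.2)]
      exact lintegral_mono fun x => Set.indicator_le_self _ _ _
    · rw [Set.indicator_of_notMem hn]
      exact (lintegral_eq_zero_of_ae_eq_zero <| .of_forall fun x =>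
        Set.indicator_of_notMem (s := transversalPairs) hn _).le
  calc ∫⁻ w, transversalPairs.indicator resonanceKernel (w, z) ∂frequencyMeasure
      ≤ ∫⁻ n, heights.indicator (fun _ => c) n ∂Measure.count := by
        rw [lintegral_prod_symm _ measurable_kernel.aemeasurable]
        exact lintegral_mono slice_le
    _ = c * Measure.count heights := lintegral_indicator_const .of_discrete _
    _ ≤ c * ENNReal.ofReal (2 * (2 * |z.1|)) := by
        gcongr
        exact count_setOf_ne_zero_abs_le (by positivity)
    _ ≤ ENNReal.ofReal (4 * √Real.pi) := by
        rw [← ENNReal.ofReal_mul (by positivity)]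
        refine ENNReal.ofReal_le_ofReal ?_
        calc √Real.pi / |z.1| * (2 * (2 * |z.1|)) = 4 * √Real.pi * (|z.1| / |z.1|) := by ring
          _ ≤ 4 * √Real.pi := mul_le_of_le_one_right (by positivity) (div_self_le_one _)

theorem le_abs_resonance_of_mem_steepPairs {s : Frequency × Frequency} (hs : s ∈ steepPairs) :
    3 / 4 * |(s.1.2 * s.2.2 : ℝ)| ≤ |resonance s| := by
  obtain ⟨-, -, hz, hw⟩ := hs
  have widths : |s.1.1 * s.2.1| ≤ |(s.1.2 * s.2.2 : ℝ)| / 4 := by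
    rw [abs_mul, abs_mul]
    linarith [mul_le_mul hz.le hw.le (by positivity) (by positivity)]
  have := abs_sub_abs_le_abs_sub (s.1.2 * s.2.2 : ℝ) (s.1.1 * s.2.1)
  rw [abs_sub_comm] at this
  unfold resonance
  linarith

theorem resonanceKernel_le_of_mem_steepPairs {s : Frequency × Frequency} (hs : s ∈ steepPairs) :
    resonanceKernel s ≤ ENNReal.ofReal (2 / ((s.1.2 : ℝ) ^ 2 * (s.2.2 : ℝ) ^ 2)) := by
  have hw : (0 : ℝ) < (s.1.2 : ℝ) ^ 2 := by have := hs.1; positivity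
  have hz : (0 : ℝ) < (s.2.2 : ℝ) ^ 2 := by have := hs.2.1; positivity
  have sq_le : (s.1.2 : ℝ) ^ 2 * (s.2.2 : ℝ) ^ 2 / 2 ≤ resonance s ^ 2 := by
    have := pow_le_pow_left₀ (by positivity) (le_abs_resonance_of_mem_steepPairs hs) 2
    rw [mul_pow, sq_abs, sq_abs, mul_pow] at this
    linarith [mul_pos hw hz]
  refine ENNReal.ofReal_le_ofReal ?_
  rw [Real.exp_neg, ← inv_div]
  exact inv_anti₀ (by positivity) (by linarith [Real.add_one_le_exp (resonance s ^ 2)])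

theorem lintegral_indicator_steepPairs_slice_le (n : ℤ) (z : Frequency) :
    ∫⁻ x : ℝ, steepPairs.indicator resonanceKernel ((x, n), z) ≤
      ENNReal.ofReal (2 * (1 / (n : ℝ) ^ 2)) := by
  set m : ℝ := |(z.2 : ℝ)| with m_def
  have pointwise (x : ℝ) : steepPairs.indicator resonanceKernel ((x, n), z) ≤
      (Set.Icc (-(m / 2)) (m / 2)).indicator
        (fun _ => ENNReal.ofReal (2 / ((n : ℝ) ^ 2 * m ^ 2))) x := by
    by_cases hs : ((x, n), z) ∈ steepPairs
    · have hx : x ∈ Set.Icc (-(m / 2)) (m / 2) := abs_le.1 (by linarith [hs.2.2.2])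
      rw [Set.indicator_of_mem hs, Set.indicator_of_mem hx, m_def, sq_abs]
      exact resonanceKernel_le_of_mem_steepPairs hs
    · rw [Set.indicator_of_notMem hs]
      exact zero_le
  refine (lintegral_mono pointwise).trans ?_
  rw [lintegral_indicator_const measurableSet_Icc, Real.volume_Icc,
    ← ENNReal.ofReal_mul (by positivity)]
  refine ENNReal.ofReal_le_ofReal ?_
  calc 2 / ((n : ℝ) ^ 2 * m ^ 2) * (m / 2 - -(m / 2)) = 2 * (1 / (n : ℝ) ^ 2) * (m / m ^ 2) := by
        ring
    _ ≤ 2 * (1 / (n : ℝ) ^ 2) := by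
        refine mul_le_of_le_one_right (by positivity) (div_le_one_of_le₀ ?_ (by positivity))
        rw [m_def]
        exact_mod_cast Int.le_self_sq |z.2|

theorem lintegral_indicator_steepPairs_le (z : Frequency) :
    ∫⁻ w, steepPairs.indicator resonanceKernel (w, z) ∂frequencyMeasure ≤
      ∑' n : ℤ, ENNReal.ofReal (2 * (1 / (n : ℝ) ^ 2)) := by
  have measurable_kernel : Measurable fun w => steepPairs.indicator resonanceKernel (w, z) :=
    (measurable_resonanceKernel.indicator measurableSet_steepPairs).comp (by fun_prop)
  rw [lintegral_prod_symm _ measurable_kernel.aemeasurable, lintegral_count]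
  exact ENNReal.tsum_le_tsum fun n => lintegral_indicator_steepPairs_slice_le n z

theorem parallelogramForm_indicator_flatPairs_le {F : Frequency → ℝ≥0∞} (hF : Measurable F) :
    parallelogramForm frequencyMeasure F (flatPairs.indicator resonanceKernel) ≤
      2 * (ENNReal.ofReal (Real.exp 1) * (2 * ENNReal.ofReal √Real.pi)) *
        (∫⁻ p, F p ^ 2 ∂frequencyMeasure) ^ 2 := by
  refine parallelogramForm_le_of_diagonal hF
    (measurable_resonanceKernel.indicator measurableSet_flatPairs) (fun s => ?_) (fun s => ?_)
  all_goals rw [lintegral_indicator_flatPairs (by fun_prop)]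
  · exact lintegral_exp_neg_mul_sub_sq_le s.1
  · refine le_of_eq_of_le (lintegral_congr fun x => ?_) (lintegral_exp_neg_mul_sub_sq_le (-s.1))
    rw [Prod.fst_add]
    ring_nf

theorem exists_parallelogramForm_resonanceKernel_le :
    ∃ C : ℝ≥0∞, C ≠ ∞ ∧ ∀ F : Frequency → ℝ≥0∞, Measurable F →
      parallelogramForm frequencyMeasure F resonanceKernel ≤
        C * (∫⁻ p, F p ^ 2 ∂frequencyMeasure) ^ 2 := by
  set A := ENNReal.ofReal (Real.exp 1) * (2 * ENNReal.ofReal √Real.pi)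
  set B := ENNReal.ofReal (4 * √Real.pi)
  set D := ∑' n : ℤ, ENNReal.ofReal (2 * (1 / (n : ℝ) ^ 2))
  have hD : D ≠ ∞ :=
    ((Real.summable_one_div_int_pow.2 one_lt_two).mul_left 2).tsum_ofReal_lt_top.ne
  refine ⟨2 * A + 2 * B + (2 * A + 2 * B) + 2 * D, by finiteness, fun F hF => ?_⟩
  have hflat := measurable_resonanceKernel.indicator measurableSet_flatPairs
  have htrans := measurable_resonanceKernel.indicator measurableSet_transversalPairs
  have hsteep := measurable_resonanceKernel.indicator measurableSet_steepPairs
  have flat_le := parallelogramForm_indicator_flatPairs_le hF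
  have trans_le := parallelogramForm_le_of_side hF htrans lintegral_indicator_transversalPairs_le
  have steep_le := parallelogramForm_le_of_side hF hsteep lintegral_indicator_steepPairs_le
  refine (parallelogramForm_mono resonanceKernel_le_sum_indicator).trans ?_
  rw [parallelogramForm_add hF ((hflat.add htrans).add ((hflat.add htrans).comp measurable_swap)),
    parallelogramForm_add hF (hflat.add htrans), parallelogramForm_comp_swap,
    parallelogramForm_add hF hflat]
  simp only [add_mul]
  gcongr

end Resonance

/-! ### Oscillatory integrals with a Gaussian weight -/

section Oscillatory

variable {Y V : Type*} [MeasurableSpace Y] {μ : Measure Y} [NormedAddCommGroup V]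
  [InnerProductSpace ℝ V]

/-- The oscillatory integral `t ↦ ∫ a e^{i⟪t, ω⟫} dμ` with amplitude `a` and phase function `ω`. -/
noncomputable def oscillatoryIntegral (μ : Measure Y) (a : Y → ℂ) (ω : Y → V) (t : V) : ℂ :=
  ∫ y, a y * Complex.exp (inner ℝ t (ω y) * Complex.I) ∂μ

theorem oscillatoryIntegral_mul_conj [SFinite μ] (a : Y → ℂ) (ω : Y → V) (t : V) :
    oscillatoryIntegral μ a ω t * (starRingEnd ℂ) (oscillatoryIntegral μ a ω t) =
      ∫ q : Y × Y, a q.1 * (starRingEnd ℂ) (a q.2) *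
        Complex.exp (inner ℝ t (ω q.1 - ω q.2) * Complex.I) ∂μ.prod μ := by
  rw [oscillatoryIntegral, ← integral_conj, ← integral_prod_mul]
  refine integral_congr_ae (.of_forall fun q => ?_)
  simp only
  rw [inner_sub_right, Complex.ofReal_sub, sub_mul, sub_eq_add_neg, Complex.exp_add, map_mul,
    ← Complex.exp_conj, map_mul, Complex.conj_ofReal, Complex.conj_I, mul_neg]
  ring

variable [MeasurableSpace V] [BorelSpace V] [SecondCountableTopology V] {ν : Measure V}
  [IsFiniteMeasure ν] {a : Y → ℂ} {ω : Y → V}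

theorem integrable_prod_mul_exp_inner_sub [SFinite μ] (ha : Integrable a μ) (hω : Measurable ω) :
    Integrable (fun q : V × (Y × Y) => a q.2.1 * (starRingEnd ℂ) (a q.2.2) *
      Complex.exp (inner ℝ q.1 (ω q.2.1 - ω q.2.2) * Complex.I)) (ν.prod (μ.prod μ)) := by
  have ha_conj : Integrable (fun y => (starRingEnd ℂ) (a y)) μ :=
    Complex.conjCLE.integrable_comp_iff.2 ha
  refine ((ha.mul_prod ha_conj).comp_snd ν).mul_bdd (c := 1)
    (Measurable.aestronglyMeasurable (by fun_prop)) (.of_forall fun q => ?_)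
  rw [Complex.norm_exp_ofReal_mul_I]

theorem integral_oscillatoryIntegral_mul_conj [SFinite μ] (ha : Integrable a μ)
    (hω : Measurable ω) :
    ∫ t, oscillatoryIntegral μ a ω t * (starRingEnd ℂ) (oscillatoryIntegral μ a ω t) ∂ν =
      ∫ q : Y × Y, a q.1 * (starRingEnd ℂ) (a q.2) * charFun ν (ω q.1 - ω q.2) ∂μ.prod μ := by
  simp_rw [oscillatoryIntegral_mul_conj]
  rw [integral_integral_swap (integrable_prod_mul_exp_inner_sub ha hω)]
  simp_rw [integral_const_mul, charFun_apply]

theorem lintegral_enorm_oscillatoryIntegral_sq_le [SFinite μ] (ha : Integrable a μ)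
    (hω : Measurable ω) :
    ∫⁻ t, ‖oscillatoryIntegral μ a ω t‖ₑ ^ 2 ∂ν ≤
      ∫⁻ y, ∫⁻ y', ‖a y‖ₑ * ‖a y'‖ₑ * ‖charFun ν (ω y - ω y')‖ₑ ∂μ ∂μ := by
  set A := oscillatoryIntegral μ a ω
  have sq_eq (t : V) : A t * (starRingEnd ℂ) (A t) = ((‖A t‖ ^ 2 : ℝ) : ℂ) := by
    rw [Complex.mul_conj, Complex.normSq_eq_norm_sq]
  have integrable_sq : Integrable (fun t => ‖A t‖ ^ 2) ν := by
    refine (integrable_prod_mul_exp_inner_sub (ν := ν) ha hω).integral_prod_left.re.congr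
      (.of_forall fun t => ?_)
    simp only [← oscillatoryIntegral_mul_conj]
    exact congrArg Complex.re (sq_eq t)
  calc ∫⁻ t, ‖A t‖ₑ ^ 2 ∂ν = ENNReal.ofReal (∫ t, ‖A t‖ ^ 2 ∂ν) := by
        rw [ofReal_integral_eq_lintegral_ofReal integrable_sq (.of_forall fun t => sq_nonneg _)]
        simp_rw [ENNReal.ofReal_pow (norm_nonneg _), ofReal_norm]
    _ = ‖∫ t, A t * (starRingEnd ℂ) (A t) ∂ν‖ₑ := by
        simp_rw [sq_eq]
        rw [integral_complex_ofReal, ← ofReal_norm, Complex.norm_real, Real.norm_of_nonneg]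
        exact integral_nonneg fun t => sq_nonneg _
    _ ≤ ∫⁻ q, ‖a q.1 * (starRingEnd ℂ) (a q.2) * charFun ν (ω q.1 - ω q.2)‖ₑ ∂μ.prod μ := by
        rw [integral_oscillatoryIntegral_mul_conj ha hω]
        exact enorm_integral_le_lintegral_enorm _
    _ = ∫⁻ y, ∫⁻ y', ‖a y‖ₑ * ‖a y'‖ₑ * ‖charFun ν (ω y - ω y')‖ₑ ∂μ ∂μ := by
        simp_rw [enorm_mul, RCLike.enorm_conj]
        refine lintegral_prod _ ((ha.1.comp_fst.enorm.mul ha.1.comp_snd.enorm).mul ?_)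
        exact Measurable.aemeasurable (by fun_prop)

end Oscillatory

theorem exists_restrict_le_smul_gaussianReal {K : Set ℝ} (hK : IsCompact K) (m : ℝ) {v : ℝ≥0}
    (hv : v ≠ 0) :
    ∃ C : ℝ≥0∞, C ≠ ∞ ∧
      (volume : Measure ℝ).restrict K ≤ C • ProbabilityTheory.gaussianReal m v := by
  have density_pos := ProbabilityTheory.gaussianPDFReal_pos m v
  have continuousOn_density : ContinuousOn (ProbabilityTheory.gaussianPDFReal m v) K := by
    rw [ProbabilityTheory.gaussianPDFReal_def]
    fun_prop
  obtain ⟨δ, hδ, le_density⟩ : ∃ δ > 0, ∀ t ∈ K, δ ≤ ProbabilityTheory.gaussianPDFReal m v t :=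
    hK.exists_forall_le' continuousOn_density fun t _ => density_pos t hv
  refine ⟨(ENNReal.ofReal δ)⁻¹, by simpa using hδ, ?_⟩
  rw [ProbabilityTheory.gaussianReal_of_var_ne_zero m hv,
    ← withDensity_smul _ (ProbabilityTheory.measurable_gaussianPDF m v),
    ← withDensity_indicator_one hK.measurableSet]
  refine withDensity_mono (.of_forall fun t => Set.indicator_le (fun t ht => ?_) t)
  rw [Pi.smul_apply, smul_eq_mul, ProbabilityTheory.gaussianPDF_def, Pi.one_apply,
    ← ENNReal.inv_mul_cancel (ENNReal.ofReal_pos.2 hδ).ne' ENNReal.ofReal_ne_top]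
  exact mul_le_mul_right (ENNReal.ofReal_le_ofReal (le_density t ht)) _

theorem enorm_charFun_gaussianReal (m : ℝ) (v : ℝ≥0) (s : ℝ) :
    ‖charFun (ProbabilityTheory.gaussianReal m v) s‖ₑ =
      ENNReal.ofReal (Real.exp (-(v * s ^ 2 / 2))) := by
  rw [ProbabilityTheory.charFun_gaussianReal, ← ofReal_norm, Complex.norm_exp]
  congr 2
  simp [← Complex.ofReal_pow]

/-! ### Fourier synthesis on the cylinder -/

section FourierInverse

variable {V E : Type*} [NormedAddCommGroup V] [InnerProductSpace ℝ V] [FiniteDimensional ℝ V]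
  [MeasurableSpace V] [BorelSpace V] [NormedAddCommGroup E] [InnerProductSpace ℂ E]
  {f : V → E}

theorem continuous_fourierInv_of_integrable (hf : Integrable f) : Continuous (𝓕⁻ f) := by
  rw [← Real.Lp.fourierTransformInv_toLp (memLp_one_iff_integrable.2 hf)]
  exact BoundedContinuousFunction.continuous _

variable [CompleteSpace E]

theorem integral_fourierInv_schwartz_smul (hf : Integrable f) (g : SchwartzMap V ℂ) :
    ∫ x, 𝓕⁻ g x • f x = ∫ x, g x • 𝓕⁻ f x := by
  have flip_neg_inner : (-innerₗ V).flip = -innerₗ V := by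
    ext
    simp [real_inner_comm]
  have h := VectorFourier.integral_fourierIntegral_smul_eq_flip (L := -innerₗ V)
    Real.continuous_fourierChar continuous_inner.neg (g.integrable (μ := volume)) hf
  rw [flip_neg_inner] at h
  rwa [SchwartzMap.fourierInv_coe]

theorem coeFn_fourierInv_toLp (hf : Integrable f) (hf2 : MemLp f 2) :
    (𝓕⁻ (hf2.toLp f) : Lp E 2) =ᵐ[volume] 𝓕⁻ f := by
  refine ae_eq_of_integral_contDiff_smul_eq ((Lp.memLp _).locallyIntegrable one_le_two)
    (continuous_fourierInv_of_integrable hf).locallyIntegrable fun g g_smooth g_supp => ?_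
  set G : SchwartzMap V ℂ := (g_supp.comp_left Complex.ofReal_zero).toSchwartzMap
    (Complex.ofRealCLM.contDiff.comp g_smooth)
  have g_smul (x : V) (y : E) : g x • y = G x • y := (Complex.coe_smul (g x) y).symm
  simp_rw [g_smul]
  calc ∫ x, G x • (𝓕⁻ (hf2.toLp f) : Lp E 2 (volume : Measure V)) x
      = ∫ x, 𝓕⁻ G x • hf2.toLp f x := by
        simpa only [TemperedDistribution.fourierInv_apply, Lp.toTemperedDistribution_apply]
          using congrArg (fun T => T G) (Lp.fourierInv_toTemperedDistribution_eq (hf2.toLp f)).symm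
    _ = ∫ x, 𝓕⁻ G x • f x := by
        refine integral_congr_ae ?_
        filter_upwards [hf2.coeFn_toLp] with x hx
        rw [hx]
    _ = ∫ x, G x • 𝓕⁻ f x := integral_fourierInv_schwartz_smul hf G

end FourierInverse

section Slices

variable {α ι E : Type*} [MeasurableSpace α] {μ : Measure α} [SFinite μ] [MeasurableSpace ι]
  [Countable ι] [NormedAddCommGroup E] {h : α × ι → E}

theorem memLp_slice {p : ℝ≥0∞} (hh : MemLp h p (μ.prod Measure.count)) (n : ι) :
    MemLp (fun x => h (x, n)) p μ := by
  have map_le : μ.map (·, n) ≤ μ.prod Measure.count := by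
    rw [← Measure.prod_dirac]
    exact Measure.prod_mono le_rfl (Measure.le_sum _ n)
  exact (hh.mono_measure map_le).comp_of_map measurable_prodMk_right.aemeasurable

variable [MeasurableSingletonClass ι]

theorem tsum_eLpNorm_slice_sq (hh : AEStronglyMeasurable h (μ.prod Measure.count)) :
    ∑' n, eLpNorm (fun x => h (x, n)) 2 μ ^ 2 = eLpNorm h 2 (μ.prod Measure.count) ^ 2 := by
  rw [eLpNorm_ofNat_pow_eq_lintegral, lintegral_prod_symm _ (hh.enorm.pow_const _),
    lintegral_count]
  exact tsum_congr fun n => eLpNorm_ofNat_pow_eq_lintegral ..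

theorem hasSum_integral_slice [NormedSpace ℝ E] [CompleteSpace E]
    (hh : Integrable h (μ.prod Measure.count)) :
    HasSum (fun n => ∫ x, h (x, n) ∂μ) (∫ p, h p ∂(μ.prod Measure.count)) := by
  have slices_integrable := hh.integral_prod_right
  rw [integral_prod_symm _ hh, integral_countable slices_integrable]
  simpa using (integrable_count_iff.1 slices_integrable).of_norm.hasSum

end Slices

/-- The character `x ↦ e^{2πi (x₁ ξ₁ + x₂ n)}` of the cylinder with frequency `(ξ₁, n)`. -/
noncomputable def cylinderCharacter (p : Frequency) (x : Cylinder) : ℂ :=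
  Real.fourierChar (p.1 * x.1) * fourier p.2 x.2

theorem norm_cylinderCharacter (p : Frequency) (x : Cylinder) : ‖cylinderCharacter p x‖ = 1 := by
  rw [cylinderCharacter, norm_mul, norm_fourier_apply, mul_one, Circle.norm_coe]

theorem cylinderCharacter_add (p q : Frequency) (x : Cylinder) :
    cylinderCharacter (p + q) x = cylinderCharacter p x * cylinderCharacter q x := by
  simp only [cylinderCharacter, Prod.fst_add, Prod.snd_add, add_mul, AddChar.map_add_eq_mul,
    Circle.coe_mul, fourier_add]
  ring

@[fun_prop]
theorem continuous_cylinderCharacter :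
    Continuous fun s : Frequency × Cylinder => cylinderCharacter s.1 s.2 := by
  simp_rw [cylinderCharacter, fourier_apply]
  fun_prop

/-- The function on the cylinder whose Fourier transform is `h`, given by the Fourier inversion
integral; it is meaningful for integrable `h`. -/
noncomputable def fourierSynthesis (h : Frequency → ℂ) (x : Cylinder) : ℂ :=
  ∫ p, cylinderCharacter p x * h p ∂frequencyMeasure

section Synthesis

variable {h : Frequency → ℂ}

theorem integrable_cylinderCharacter_mul (hh : Integrable h frequencyMeasure) (x : Cylinder) :
    Integrable (fun p => cylinderCharacter p x * h p) frequencyMeasure :=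
  hh.bdd_mul (c := 1) (by fun_prop)
    (Filter.Eventually.of_forall fun p => (norm_cylinderCharacter p x).le)

theorem hasSum_fourierSynthesis (hh : Integrable h frequencyMeasure) (x : Cylinder) :
    HasSum (fun n => 𝓕⁻ (fun ξ => h (ξ, n)) x.1 * fourier n x.2) (fourierSynthesis h x) := by
  refine (hasSum_integral_slice (integrable_cylinderCharacter_mul hh x)).congr_fun fun n => ?_
  rw [Real.fourierInv_eq, ← integral_mul_const]
  refine integral_congr_ae (Filter.Eventually.of_forall fun ξ => ?_)
  simp only [cylinderCharacter, Circle.smul_def, smul_eq_mul, RCLike.inner_apply, conj_trivial]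
  ring_nf

theorem fourierSynthesis_mul_self (hh : Integrable h frequencyMeasure) (x : Cylinder) :
    fourierSynthesis h x * fourierSynthesis h x =
      fourierSynthesis (convolution h h (ContinuousLinearMap.mul ℂ ℂ) frequencyMeasure) x := by
  have hint := integrable_cylinderCharacter_mul hh x
  have h1 := integral_convolution (ContinuousLinearMap.mul ℂ ℂ) hint hint
  rw [ContinuousLinearMap.mul_apply'] at h1
  unfold fourierSynthesis
  rw [← h1]
  congr 1 with c
  simp only [convolution_def, ContinuousLinearMap.mul_apply']
  rw [← integral_const_mul]
  congr 1 with p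
  have split := cylinderCharacter_add p (c - p) x
  rw [add_sub_cancel] at split
  rw [split]
  ring

end Synthesis

/-- The inverse Fourier transform followed by the tensor product with the `n`-th character, as an
isometry of `L²(ℝ)` into `L²(ℝ × 𝕋)`. -/
noncomputable def synthesisMode (n : ℤ) : L2Line →ₗᵢ[ℂ] L2Cylinder :=
  (tensorModeIsometry n).comp (Lp.fourierTransformₗᵢ ℝ ℂ).symm.toLinearIsometry

theorem synthesisMode_apply (n : ℤ) (g : L2Line) : synthesisMode n g = tensorMode (𝓕⁻ g) n :=
  rfl

theorem orthogonalFamily_synthesisMode :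
    OrthogonalFamily ℂ (fun _ : ℤ => L2Line) synthesisMode := fun _ _ hmn g g' =>
  orthogonalFamily_tensorMode hmn (𝓕⁻ g) (𝓕⁻ g')

section L2Synthesis

variable {h h' : Frequency → ℂ}

theorem tsum_enorm_toLp_slice_sq (hh : MemLp h 2 frequencyMeasure) :
    ∑' n, ‖(memLp_slice hh n).toLp _‖ₑ ^ 2 = eLpNorm h 2 frequencyMeasure ^ 2 := by
  simp_rw [Lp.enorm_toLp]
  exact tsum_eLpNorm_slice_sq hh.1

theorem summable_norm_toLp_slice_sq (hh : MemLp h 2 frequencyMeasure) :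
    Summable fun n => ‖(memLp_slice hh n).toLp _‖ ^ 2 := by
  have := ENNReal.summable_toReal
    ((tsum_enorm_toLp_slice_sq hh).trans_ne (ENNReal.pow_ne_top hh.2.ne))
  simpa using this

/-- The sequence of slices `n ↦ h(·, n)` of `h ∈ L²(ℝ × ℤ)`, in the Hilbert sum of the `L²(ℝ)`. -/
noncomputable def frequencySlices (hh : MemLp h 2 frequencyMeasure) :
    lp (fun _ : ℤ => L2Line) 2 :=
  ⟨fun n => (memLp_slice hh n).toLp _,
    memℓp_gen (by simpa using summable_norm_toLp_slice_sq hh)⟩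

theorem enorm_frequencySlices (hh : MemLp h 2 frequencyMeasure) :
    ‖frequencySlices hh‖ₑ = eLpNorm h 2 frequencyMeasure := by
  refine (ENNReal.pow_right_strictMono two_ne_zero).injective ?_
  have norm_sq : ‖frequencySlices hh‖ ^ 2 = ∑' n, ‖(memLp_slice hh n).toLp _‖ ^ 2 := by
    have := lp.norm_rpow_eq_tsum (p := 2) (by norm_num) (frequencySlices hh)
    simp only [ENNReal.toReal_ofNat, Real.rpow_ofNat] at this
    exact this
  calc ‖frequencySlices hh‖ₑ ^ 2 = ENNReal.ofReal (‖frequencySlices hh‖ ^ 2) := by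
        rw [ENNReal.ofReal_pow (norm_nonneg _), ofReal_norm]
    _ = ∑' n, ‖(memLp_slice hh n).toLp _‖ₑ ^ 2 := by
        rw [norm_sq, ENNReal.ofReal_tsum_of_nonneg (fun n => sq_nonneg _)
          (summable_norm_toLp_slice_sq hh)]
        simp_rw [ENNReal.ofReal_pow (norm_nonneg _), ofReal_norm]
    _ = eLpNorm h 2 frequencyMeasure ^ 2 := tsum_enorm_toLp_slice_sq hh

theorem frequencySlices_sub (hh : MemLp h 2 frequencyMeasure) (hh' : MemLp h' 2 frequencyMeasure) :
    frequencySlices (hh.sub hh') = frequencySlices hh - frequencySlices hh' :=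
  rfl

/-- The element of `L²(ℝ × 𝕋)` whose Fourier transform is `h ∈ L²(ℝ × ℤ)`. -/
noncomputable def fourierSynthesisL2 (hh : MemLp h 2 frequencyMeasure) : L2Cylinder :=
  orthogonalFamily_synthesisMode.linearIsometry (frequencySlices hh)

theorem enorm_fourierSynthesisL2_sub (hh : MemLp h 2 frequencyMeasure)
    (hh' : MemLp h' 2 frequencyMeasure) :
    ‖fourierSynthesisL2 hh - fourierSynthesisL2 hh'‖ₑ = eLpNorm (h - h') 2 frequencyMeasure := by
  rw [fourierSynthesisL2, fourierSynthesisL2, ← map_sub, ← frequencySlices_sub,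
    LinearIsometry.enorm_map, enorm_frequencySlices]

theorem enorm_fourierSynthesisL2 (hh : MemLp h 2 frequencyMeasure) :
    ‖fourierSynthesisL2 hh‖ₑ = eLpNorm h 2 frequencyMeasure := by
  rw [fourierSynthesisL2, LinearIsometry.enorm_map, enorm_frequencySlices]

theorem coeFn_synthesisMode_toLp_slice (hh : Integrable h frequencyMeasure)
    (hh2 : MemLp h 2 frequencyMeasure) (n : ℤ) :
    synthesisMode n ((memLp_slice hh2 n).toLp _) =ᵐ[volume]
      fun x => 𝓕⁻ (fun ξ => h (ξ, n)) x.1 * fourier n x.2 := by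
  have := isProbabilityMeasure_unitAddCircle
  have slice_integrable : Integrable fun ξ => h (ξ, n) :=
    memLp_one_iff_integrable.1 (memLp_slice (memLp_one_iff_integrable.2 hh) n)
  filter_upwards [coeFn_tensorMode (𝓕⁻ ((memLp_slice hh2 n).toLp _)) n,
    Measure.quasiMeasurePreserving_fst.ae (coeFn_fourierInv_toLp slice_integrable _)] with x hx hx₁
  rw [synthesisMode_apply, hx, hx₁]

theorem coeFn_fourierSynthesisL2 (hh : Integrable h frequencyMeasure)
    (hh2 : MemLp h 2 frequencyMeasure) :
    fourierSynthesisL2 hh2 =ᵐ[volume] fourierSynthesis h := by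
  have tendsto_L2 := orthogonalFamily_synthesisMode.hasSum_linearIsometry (frequencySlices hh2)
  obtain ⟨S, hS, tendsto_ae⟩ := (tendstoInMeasure_of_tendsto_Lp tendsto_L2).exists_seq_tendsto_ae'
  filter_upwards [tendsto_ae, ae_all_iff.2 fun k => Lp.coeFn_finsetSum (S k)
      fun n => synthesisMode n ((memLp_slice hh2 n).toLp _),
    ae_all_iff.2 (coeFn_synthesisMode_toLp_slice hh hh2)] with x hx sum_apply mode_apply
  refine tendsto_nhds_unique hx (((hasSum_fourierSynthesis hh x).comp hS).congr fun k => ?_)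
  refine Eq.trans ?_ (sum_apply k).symm
  rw [Finset.sum_apply]
  exact Finset.sum_congr rfl fun n _ => (mode_apply n).symm

theorem eLpNorm_fourierSynthesis (hh : Integrable h frequencyMeasure)
    (hh2 : MemLp h 2 frequencyMeasure) :
    eLpNorm (fourierSynthesis h) 2 volume = eLpNorm h 2 frequencyMeasure := by
  rw [← eLpNorm_congr_ae (coeFn_fourierSynthesisL2 hh hh2), ← enorm_fourierSynthesisL2 hh2,
    Lp.enorm_def]

end L2Synthesis

/-! ### The estimate for smooth data -/

theorem lintegral_enorm_fourierSynthesis_pow_four {h : Frequency → ℂ} (hc : Continuous h)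
    (hs : HasCompactSupport h) :
    ∫⁻ x, ‖fourierSynthesis h x‖ₑ ^ 4 =
      ∫⁻ c, ‖convolution h h (ContinuousLinearMap.mul ℂ ℂ) frequencyMeasure c‖ₑ ^ 2
        ∂frequencyMeasure := by
  set H := convolution h h (ContinuousLinearMap.mul ℂ ℂ) frequencyMeasure
  have hHc : Continuous H := hs.continuous_convolution_right _ hc.locallyIntegrable hc
  have hHs : HasCompactSupport H := hs.convolution _ hs
  calc ∫⁻ x, ‖fourierSynthesis h x‖ₑ ^ 4
      = ∫⁻ x, ‖fourierSynthesis H x‖ₑ ^ 2 := by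
        refine lintegral_congr fun x => ?_
        rw [← fourierSynthesis_mul_self (hc.integrable_of_hasCompactSupport hs), enorm_mul]
        ring
    _ = ∫⁻ c, ‖H c‖ₑ ^ 2 ∂frequencyMeasure := by
        rw [← eLpNorm_ofNat_pow_eq_lintegral, ← eLpNorm_ofNat_pow_eq_lintegral,
          eLpNorm_fourierSynthesis (hHc.integrable_of_hasCompactSupport hHs)
            (hHc.memLp_of_hasCompactSupport hHs)]

/-- The time frequency `-4π² (ξ₁² - n²)` at which the mode `(ξ₁, n)` oscillates. -/
noncomputable def frequencyPhase (p : Frequency) : ℝ :=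
  -4 * Real.pi ^ 2 * (p.1 ^ 2 - (p.2 : ℝ) ^ 2)

@[fun_prop]
theorem continuous_frequencyPhase : Continuous frequencyPhase := by
  have : Continuous fun n : ℤ => (n : ℝ) := continuous_of_discreteTopology
  unfold frequencyPhase
  fun_prop

theorem frequencyPhase_parallelogram (c p q : Frequency) :
    frequencyPhase p + frequencyPhase (c - p) - (frequencyPhase q + frequencyPhase (c - q)) =
      -8 * Real.pi ^ 2 * resonance (p - q, p + q - c) := by
  simp only [frequencyPhase, resonance, Prod.fst_sub, Prod.snd_sub, Prod.fst_add, Prod.snd_add,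
    Int.cast_sub, Int.cast_add]
  ring

theorem enorm_charFun_gaussianReal_phase_le (c p q : Frequency) :
    ‖charFun (ProbabilityTheory.gaussianReal 0 1)
        (frequencyPhase p + frequencyPhase (c - p) -
          (frequencyPhase q + frequencyPhase (c - q)))‖ₑ ≤
      resonanceKernel (p - q, p + q - c) := by
  rw [frequencyPhase_parallelogram, enorm_charFun_gaussianReal, NNReal.coe_one,
    one_mul]
  refine ENNReal.ofReal_le_ofReal (Real.exp_le_exp.2 (neg_le_neg ?_))
  have pi_pow : 1 ≤ Real.pi ^ 4 := one_le_pow₀ (by linarith [Real.pi_gt_three])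
  linarith [le_mul_of_one_le_left (sq_nonneg (resonance (p - q, p + q - c))) pi_pow,
    mul_nonneg (zero_le_one.trans pi_pow) (sq_nonneg (resonance (p - q, p + q - c)))]

/-- The evolution of a Fourier transform under the flow. -/
noncomputable def frequencyFlow (t : ℝ) (h : Frequency → ℂ) (p : Frequency) : ℂ :=
  flowSymbol t p.2 p.1 * h p

theorem flowSymbol_eq_exp_frequencyPhase (t : ℝ) (p : Frequency) :
    flowSymbol t p.2 p.1 = Complex.exp ((t * frequencyPhase p : ℝ) * Complex.I) := by
  rw [flowSymbol, frequencyPhase]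
  ring_nf

section FrequencyFlow

variable {h : Frequency → ℂ}

theorem norm_frequencyFlow (t : ℝ) (h : Frequency → ℂ) (p : Frequency) :
    ‖frequencyFlow t h p‖ = ‖h p‖ := by
  rw [frequencyFlow, norm_mul, norm_flowSymbol, one_mul]

theorem eLpNorm_frequencyFlow (t : ℝ) (h : Frequency → ℂ) :
    eLpNorm (frequencyFlow t h) 2 frequencyMeasure = eLpNorm h 2 frequencyMeasure :=
  eLpNorm_congr_norm_ae (Filter.Eventually.of_forall (norm_frequencyFlow t h))

theorem frequencyFlow_sub (t : ℝ) (h h' : Frequency → ℂ) :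
    frequencyFlow t (h - h') = frequencyFlow t h - frequencyFlow t h' :=
  funext fun _ => mul_sub _ _ _

theorem continuous_frequencyFlow_uncurry (hc : Continuous h) :
    Continuous fun s : ℝ × Frequency => frequencyFlow s.1 h s.2 := by
  simp_rw [frequencyFlow, flowSymbol_eq_exp_frequencyPhase]
  fun_prop

theorem continuous_frequencyFlow (hc : Continuous h) (t : ℝ) : Continuous (frequencyFlow t h) :=
  (continuous_frequencyFlow_uncurry hc).comp (Continuous.prodMk_right t)

theorem hasCompactSupport_frequencyFlow (hs : HasCompactSupport h) (t : ℝ) :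
    HasCompactSupport (frequencyFlow t h) :=
  hs.mul_left

theorem memLp_frequencyFlow (hh : MemLp h 2 frequencyMeasure) (t : ℝ) :
    MemLp (frequencyFlow t h) 2 frequencyMeasure := by
  have symbol_continuous : Continuous fun p : Frequency => flowSymbol t p.2 p.1 := by
    simp_rw [flowSymbol_eq_exp_frequencyPhase]
    fun_prop
  exact hh.of_le (symbol_continuous.aestronglyMeasurable.mul hh.1)
    (Filter.Eventually.of_forall fun p => (norm_frequencyFlow t h p).le)

theorem convolution_frequencyFlow (h : Frequency → ℂ) (t : ℝ) (c : Frequency) :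
    convolution (frequencyFlow t h) (frequencyFlow t h) (ContinuousLinearMap.mul ℂ ℂ)
        frequencyMeasure c =
      oscillatoryIntegral frequencyMeasure (fun p => h p * h (c - p))
        (fun p => frequencyPhase p + frequencyPhase (c - p)) t := by
  rw [convolution_def, oscillatoryIntegral]
  congr 1 with p
  simp only [ContinuousLinearMap.mul_apply', frequencyFlow, flowSymbol_eq_exp_frequencyPhase,
    RCLike.inner_apply, conj_trivial]
  rw [mul_mul_mul_comm, ← Complex.exp_add, mul_comm]
  push_cast
  ring_nf

theorem measurable_convolution_frequencyFlow (hc : Continuous h) :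
    Measurable fun s : ℝ × Frequency => convolution (frequencyFlow s.1 h) (frequencyFlow s.1 h)
      (ContinuousLinearMap.mul ℂ ℂ) frequencyMeasure s.2 := by
  have hflow := continuous_frequencyFlow_uncurry hc
  simp_rw [convolution_def, ContinuousLinearMap.mul_apply']
  refine StronglyMeasurable.measurable (StronglyMeasurable.integral_prod_right' (f :=
    fun s : (ℝ × Frequency) × Frequency =>
      frequencyFlow s.1.1 h s.2 * frequencyFlow s.1.1 h (s.1.2 - s.2)) ?_)
  exact (Continuous.mul (hflow.comp (by fun_prop : Continuous
      fun s : (ℝ × Frequency) × Frequency => (s.1.1, s.2)))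
    (hflow.comp (by fun_prop : Continuous
      fun s : (ℝ × Frequency) × Frequency => (s.1.1, s.1.2 - s.2)))).stronglyMeasurable

theorem lintegral_enorm_convolution_frequencyFlow_sq_le (hc : Continuous h)
    (hs : HasCompactSupport h) :
    ∫⁻ c, ∫⁻ t, ‖convolution (frequencyFlow t h) (frequencyFlow t h) (ContinuousLinearMap.mul ℂ ℂ)
        frequencyMeasure c‖ₑ ^ 2 ∂ProbabilityTheory.gaussianReal 0 1 ∂frequencyMeasure ≤
      parallelogramForm frequencyMeasure (fun p => ‖h p‖ₑ) resonanceKernel := by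
  refine lintegral_mono fun c => ?_
  have amplitude_integrable : Integrable (fun p => h p * h (c - p)) frequencyMeasure :=
    (by fun_prop : Continuous fun p => h p * h (c - p)).integrable_of_hasCompactSupport hs.mul_right
  simp_rw [convolution_frequencyFlow]
  refine (lintegral_enorm_oscillatoryIntegral_sq_le amplitude_integrable (by fun_prop)).trans ?_
  gcongr with p q
  · exact (enorm_mul _ _).le
  · exact (enorm_mul _ _).le
  · exact enorm_charFun_gaussianReal_phase_le c p q

end FrequencyFlow

theorem exists_lintegral_enorm_fourierSynthesis_frequencyFlow_le :
    ∃ C : ℝ≥0∞, C ≠ ∞ ∧ ∀ h : Frequency → ℂ, Continuous h → HasCompactSupport h →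
      ∫⁻ t in Set.Icc (0 : ℝ) 1, ∫⁻ x, ‖fourierSynthesis (frequencyFlow t h) x‖ₑ ^ 4 ≤
        C * (∫⁻ p, ‖h p‖ₑ ^ 2 ∂frequencyMeasure) ^ 2 := by
  obtain ⟨C₁, hC₁, window_le⟩ :=
    exists_restrict_le_smul_gaussianReal (K := Set.Icc 0 1) isCompact_Icc 0 one_ne_zero
  obtain ⟨C₂, hC₂, form_le⟩ := exists_parallelogramForm_resonanceKernel_le
  refine ⟨C₁ * C₂, by finiteness, fun h hc hs => ?_⟩
  set H : ℝ → Frequency → ℂ := fun t => convolution (frequencyFlow t h) (frequencyFlow t h)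
    (ContinuousLinearMap.mul ℂ ℂ) frequencyMeasure
  have hH : Measurable fun s : ℝ × Frequency => ‖H s.1 s.2‖ₑ ^ 2 :=
    (measurable_convolution_frequencyFlow hc).enorm.pow_const 2
  calc ∫⁻ t in Set.Icc (0 : ℝ) 1, ∫⁻ x, ‖fourierSynthesis (frequencyFlow t h) x‖ₑ ^ 4
      = ∫⁻ t in Set.Icc (0 : ℝ) 1, ∫⁻ c, ‖H t c‖ₑ ^ 2 ∂frequencyMeasure :=
        lintegral_congr fun t => lintegral_enorm_fourierSynthesis_pow_four
          (continuous_frequencyFlow hc t) (hasCompactSupport_frequencyFlow hs t)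
    _ ≤ ∫⁻ t, ∫⁻ c, ‖H t c‖ₑ ^ 2 ∂frequencyMeasure
          ∂(C₁ • ProbabilityTheory.gaussianReal 0 1) :=
        lintegral_mono' window_le le_rfl
    _ = C₁ * ∫⁻ c, ∫⁻ t, ‖H t c‖ₑ ^ 2 ∂ProbabilityTheory.gaussianReal 0 1 ∂frequencyMeasure := by
        rw [lintegral_smul_measure, smul_eq_mul, lintegral_lintegral_swap hH.aemeasurable]
    _ ≤ C₁ * (C₂ * (∫⁻ p, ‖h p‖ₑ ^ 2 ∂frequencyMeasure) ^ 2) := by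
        gcongr
        exact (lintegral_enorm_convolution_frequencyFlow_sq_le hc hs).trans
          (form_le _ hc.measurable.enorm)
    _ = C₁ * C₂ * (∫⁻ p, ‖h p‖ₑ ^ 2 ∂frequencyMeasure) ^ 2 := (mul_assoc _ _ _).symm

/-- The smooth solution `(t, x) ↦ (e^{it(∂₁² - ∂₂²)} φ)(x)` with initial Fourier transform `h`,
defined pointwise by the Fourier inversion integral. -/
noncomputable def frequencySolution (h : Frequency → ℂ) (s : ℝ × Cylinder) : ℂ :=
  fourierSynthesis (frequencyFlow s.1 h) s.2

section Solution

variable {h : Frequency → ℂ}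

theorem continuous_frequencySolution (hc : Continuous h) (hs : HasCompactSupport h) :
    Continuous (frequencySolution h) := by
  refine continuous_of_dominated (bound := fun p => ‖h p‖) (fun s => ?_)
    (fun s => Filter.Eventually.of_forall fun p => ?_)
    (hc.integrable_of_hasCompactSupport hs).norm (Filter.Eventually.of_forall fun p => ?_)
  · have flow_integrable := (continuous_frequencyFlow hc s.1).integrable_of_hasCompactSupport
      (μ := frequencyMeasure) (hasCompactSupport_frequencyFlow hs s.1)
    exact (integrable_cylinderCharacter_mul flow_integrable s.2).1
  · rw [norm_mul, norm_cylinderCharacter, one_mul, norm_frequencyFlow]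
  · have := continuous_frequencyFlow_uncurry hc
    fun_prop

theorem exists_eLpNorm_frequencySolution_le :
    ∃ C : ℝ≥0, ∀ h : Frequency → ℂ, Continuous h → HasCompactSupport h →
      eLpNorm (frequencySolution h) 4 spaceTimeMeasure ≤ C * eLpNorm h 2 frequencyMeasure := by
  obtain ⟨C, hC, estimate⟩ := exists_lintegral_enorm_fourierSynthesis_frequencyFlow_le
  lift C to ℝ≥0 using hC
  refine ⟨C ^ (1 / 4 : ℝ), fun h hc hs => ?_⟩
  refine (ENNReal.pow_right_strictMono four_ne_zero).le_iff_le.1 ?_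
  have root_pow : ((C ^ (1 / 4 : ℝ) : ℝ≥0) : ℝ≥0∞) ^ 4 = C := by
    rw [← ENNReal.coe_pow, ← NNReal.rpow_natCast, ← NNReal.rpow_mul]
    norm_num
  have hm := (continuous_frequencySolution hc hs).measurable.enorm.pow_const 4
  rw [eLpNorm_ofNat_pow_eq_lintegral]
  refine (lintegral_prod _ hm.aemeasurable).trans_le ((estimate h hc hs).trans_eq ?_)
  rw [mul_pow, root_pow, ← eLpNorm_ofNat_pow_eq_lintegral, ← pow_mul]

end Solution

/-! ### General data -/

theorem eLpNorm_two_prod_eq_of_ae_eq {α β E : Type*} [MeasurableSpace α] [MeasurableSpace β]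
    [NormedAddCommGroup E] {μ : Measure α} [IsProbabilityMeasure μ] {ν : Measure β} [SFinite ν]
    {f : α × β → E} (hf : AEStronglyMeasurable f (μ.prod ν)) {N : ℝ≥0∞}
    (hN : ∀ᵐ t ∂μ, eLpNorm (fun x => f (t, x)) 2 ν = N) : eLpNorm f 2 (μ.prod ν) = N := by
  refine (ENNReal.pow_right_strictMono two_ne_zero).injective ?_
  calc eLpNorm f 2 (μ.prod ν) ^ 2 = ∫⁻ t, ∫⁻ x, ‖f (t, x)‖ₑ ^ 2 ∂ν ∂μ := by
        rw [eLpNorm_ofNat_pow_eq_lintegral, lintegral_prod _ (hf.enorm.pow_const 2)]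
    _ = ∫⁻ _, N ^ 2 ∂μ := by
        refine lintegral_congr_ae ?_
        filter_upwards [hN] with t ht
        rw [← ht, eLpNorm_ofNat_pow_eq_lintegral]
    _ = N ^ 2 := by simp

/-- The Fourier transform of `φ` as a function on `ℝ × ℤ`. -/
noncomputable def fourierData (φ : L2Cylinder) (p : Frequency) : ℂ :=
  cylinderFourier φ p.2 p.1

theorem measurable_fourierData (φ : L2Cylinder) : Measurable (fourierData φ) :=
  measurable_from_prod_countable_left fun n =>
    (Lp.stronglyMeasurable (cylinderFourier φ n)).measurable

theorem eLpNorm_fourierData_sq (φ : L2Cylinder) :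
    eLpNorm (fourierData φ) 2 frequencyMeasure ^ 2 = ∑' n, ‖partialCoeff φ n‖ₑ ^ 2 := by
  rw [← tsum_eLpNorm_slice_sq (measurable_fourierData φ).aestronglyMeasurable]
  refine tsum_congr fun n => ?_
  rw [← ofReal_norm (partialCoeff φ n), ← Lp.norm_fourier_eq, ofReal_norm, Lp.enorm_def]
  rfl

theorem eLpNorm_fourierData_le (φ : L2Cylinder) :
    eLpNorm (fourierData φ) 2 frequencyMeasure ≤ eLpNorm φ 2 volume := by
  refine (ENNReal.pow_right_strictMono two_ne_zero).le_iff_le.1 ?_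
  rw [eLpNorm_fourierData_sq, ← Lp.enorm_def]
  refine ENNReal.summable.tsum_le_of_sum_le fun s => ?_
  have bessel := ENNReal.ofReal_le_ofReal (sum_sq_norm_partialCoeff_le φ s)
  rw [ENNReal.ofReal_sum_of_nonneg fun _ _ => sq_nonneg _] at bessel
  simpa only [ENNReal.ofReal_pow (norm_nonneg _), ofReal_norm] using bessel

theorem memLp_fourierData (φ : L2Cylinder) : MemLp (fourierData φ) 2 frequencyMeasure :=
  ⟨(measurable_fourierData φ).aestronglyMeasurable,
    (eLpNorm_fourierData_le φ).trans_lt (Lp.memLp φ).2⟩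

theorem fourierSynthesisL2_frequencyFlow_fourierData (t : ℝ) (φ : L2Cylinder) :
    fourierSynthesisL2 (memLp_frequencyFlow (memLp_fourierData φ) t) = hyperbolicFlow t φ :=
  orthogonalFamily_synthesisMode.linearIsometry_apply _

section Approximation

variable {h : Frequency → ℂ}

theorem eLpNorm_frequencySolution_sub_hyperbolicFlow (hc : Continuous h) (hs : HasCompactSupport h)
    (φ : L2Cylinder) (t : ℝ) :
    eLpNorm ((fun x => frequencySolution h (t, x)) - ⇑(hyperbolicFlow t φ)) 2 volume =
      eLpNorm (h - fourierData φ) 2 frequencyMeasure := by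
  have hct := continuous_frequencyFlow hc t
  have hst := hasCompactSupport_frequencyFlow hs t
  have flow_memLp := hct.memLp_of_hasCompactSupport (μ := frequencyMeasure) (p := 2) hst
  rw [← eLpNorm_frequencyFlow t, frequencyFlow_sub,
    ← enorm_fourierSynthesisL2_sub flow_memLp (memLp_frequencyFlow (memLp_fourierData φ) t),
    fourierSynthesisL2_frequencyFlow_fourierData, Lp.enorm_def]
  refine eLpNorm_congr_ae ?_
  filter_upwards [coeFn_fourierSynthesisL2 (hct.integrable_of_hasCompactSupport hst) flow_memLp,
    Lp.coeFn_sub (fourierSynthesisL2 flow_memLp) (hyperbolicFlow t φ)] with x hx hsub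
  rw [hsub, Pi.sub_apply, Pi.sub_apply, hx, frequencySolution]

theorem eLpNorm_frequencySolution_sub (hc : Continuous h) (hs : HasCompactSupport h)
    {φ : L2Cylinder} {u : ℝ × Cylinder → ℂ} (hu : RepresentsFlow φ u) :
    eLpNorm (frequencySolution h - u) 2 spaceTimeMeasure =
      eLpNorm (h - fourierData φ) 2 frequencyMeasure := by
  have : IsProbabilityMeasure ((volume : Measure ℝ).restrict (Set.Icc 0 1)) := ⟨by simp⟩
  refine eLpNorm_two_prod_eq_of_ae_eq (f := frequencySolution h - u)
    ((continuous_frequencySolution hc hs).aestronglyMeasurable.sub hu.1) ?_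
  filter_upwards [hu.2] with t ht
  rw [← eLpNorm_frequencySolution_sub_hyperbolicFlow hc hs φ t]
  exact eLpNorm_congr_ae (ht.mono fun x hx => congrArg (frequencySolution h (t, x) - ·) hx)

end Approximation

theorem exists_representsFlow (φ : L2Cylinder) : ∃ u, RepresentsFlow φ u := by
  obtain ⟨h, hc, hs, h_approx⟩ := exists_continuous_hasCompactSupport_tsum_eLpNorm_sub_ne_top
    ENNReal.ofNat_ne_top (memLp_fourierData φ)
  have sol_continuous := fun k => continuous_frequencySolution (hc k) (hs k)
  -- The approximating sequence does not depend on `t`, so its limit is jointly measurable.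
  refine ⟨fun s => Filter.atTop.limUnder fun k => frequencySolution (h k) s,
    (StronglyMeasurable.limUnder fun k =>
      (sol_continuous k).stronglyMeasurable).aestronglyMeasurable,
    Filter.Eventually.of_forall fun t => ?_⟩
  have slice_tendsto := ae_tendsto_of_tsum_eLpNorm_sub_ne_top one_le_two
    (f := fun k x => frequencySolution (h k) (t, x)) (g := hyperbolicFlow t φ)
    (fun k => ((sol_continuous k).comp (Continuous.prodMk_right t)).aestronglyMeasurable)
    (Lp.memLp _).1 (by
      simpa only [eLpNorm_frequencySolution_sub_hyperbolicFlow (hc _) (hs _)] using h_approx)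
  filter_upwards [slice_tendsto] with x hx
  exact hx.limUnder_eq

theorem eLpNorm_le_of_frequencySolution_le {C : ℝ≥0} (estimate : ∀ h : Frequency → ℂ,
      Continuous h → HasCompactSupport h →
        eLpNorm (frequencySolution h) 4 spaceTimeMeasure ≤ C * eLpNorm h 2 frequencyMeasure)
    {φ : L2Cylinder} {u : ℝ × Cylinder → ℂ} (hu : RepresentsFlow φ u) :
    eLpNorm u 4 spaceTimeMeasure ≤ C * eLpNorm (fourierData φ) 2 frequencyMeasure := by
  obtain ⟨h, hc, hs, h_approx⟩ := exists_continuous_hasCompactSupport_tsum_eLpNorm_sub_ne_top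
    ENNReal.ofNat_ne_top (memLp_fourierData φ)
  have sol_measurable := fun k =>
    (continuous_frequencySolution (hc k) (hs k)).aestronglyMeasurable (μ := spaceTimeMeasure)
  have sol_tendsto : ∀ᵐ s ∂spaceTimeMeasure,
      Filter.Tendsto (fun k => frequencySolution (h k) s) Filter.atTop (nhds (u s)) :=
    ae_tendsto_of_tsum_eLpNorm_sub_ne_top one_le_two sol_measurable hu.1
      (by simpa only [eLpNorm_frequencySolution_sub (hc _) (hs _) hu] using h_approx)
  have sol_le (k : ℕ) : eLpNorm (frequencySolution (h k)) 4 spaceTimeMeasure ≤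
      C * (eLpNorm (h k - fourierData φ) 2 frequencyMeasure +
        eLpNorm (fourierData φ) 2 frequencyMeasure) := by
    refine (estimate _ (hc k) (hs k)).trans ?_
    gcongr
    have := eLpNorm_add_le ((hc k).aestronglyMeasurable.sub (memLp_fourierData φ).1)
      (memLp_fourierData φ).1 one_le_two
    rwa [sub_add_cancel] at this
  have bound_tendsto := ENNReal.Tendsto.const_mul (a := (C : ℝ≥0∞))
    ((ENNReal.tendsto_atTop_zero_of_tsum_ne_top h_approx).add_const
      (eLpNorm (fourierData φ) 2 frequencyMeasure)) (Or.inr ENNReal.coe_ne_top)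
  rw [zero_add] at bound_tendsto
  exact (Lp.eLpNorm_lim_le_liminf_eLpNorm sol_measurable u sol_tendsto).trans
    ((Filter.liminf_le_liminf (Filter.Eventually.of_forall sol_le)).trans_eq
      bound_tendsto.liminf_eq)

theorem theorem1p1 :
    ∃ C : ℝ≥0, ∀ φ : L2Cylinder,
      (∃ u : ℝ × Cylinder → ℂ, RepresentsFlow φ u) ∧
        ∀ u : ℝ × Cylinder → ℂ, RepresentsFlow φ u →
          eLpNorm u 4 spaceTimeMeasure ≤ (C : ℝ≥0∞) * eLpNorm φ 2 (volume : Measure Cylinder) := by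
  obtain ⟨C, estimate⟩ := exists_eLpNorm_frequencySolution_le
  refine ⟨C, fun φ => ⟨exists_representsFlow φ, fun u hu => ?_⟩⟩
  calc eLpNorm u 4 spaceTimeMeasure
      ≤ C * eLpNorm (fourierData φ) 2 frequencyMeasure :=
        eLpNorm_le_of_frequencySolution_le estimate hu
    _ ≤ C * eLpNorm φ 2 volume := by
        gcongr
        exact eLpNorm_fourierData_le φ
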